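/- Let $\mathcal H$ be a complex Hilbert space of finite dimension $n$ with orthonormal basis $\varphi_1,\dots,\varphi_n$. For $k=2,3$ let $A^k=\frac1{k!}\sum_\sigma \mathrm{sgn}(\sigma)U_\sigma$ be the antisymmetrizer on $\mathcal H^{\otimes k}$, let $\mathcal H^{\wedge k}$ be its range, and write $x_1\wedge\dots\wedge x_k=A^k(x_1\otimes\dots\otimes x_k)$, $|i,j\rangle=\sqrt{2!}\,\varphi_i\wedge\varphi_j$, $|i,j,k\rangle=\sqrt{3!}\,\varphi_i\wedge\varphi_j\wedge\varphi_k$. Let $r=2s\le n$ and $$g=\sum_{i=1}^{s}\xi_i\,|2i-1,2i\rangle,\qquad \xi_i\in\mathbb C\setminus\{0\},\qquad \sum_{i=1}^s|\xi_i|^2=1 .$$ For a unit vector $f$ let $P_f$ be the orthogonal projection onto $\mathbb Cf$, let $P_{a,b,c}$ be the projection onto $|a,b,c\rangle$, and let $$3P_g\wedge I=A^3\Big(\sum_{1\le i<j\le3}P_g(i,j)\Big)A^3:\ \mathcal H^{\wedge3}\to\mathcal H^{\wedge3},$$ where $P_g(i,j)$ is $P_g$ acting on the particles $i,j$. Put $\mathcal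 R=\mathrm{span}\{\varphi_i\}_{i\le r}$ and $\widetilde{\mathcal R}=\mathrm{span}\{\varphi_i\}_{i>r}$; for subspaces $A,B,C$ let $A\wedge B\wedge C$ be the span of all $a\wedge b\wedge c$ with $a\in A$, $b\in B$, $c\in C$. Define $$f_{l,m}=N_{l,m}\Big(\sum_{i<m}\xi_i\overline{\xi_m}\,|2i-1,2i,l\rangle-\sum_{i<m}|\xi_i|^2\,|2m-1,2m,l\rangle\Big),\quad N_{l,m}=\Big(\sum_{i<m}|\xi_i|^2\Big)^{-1/2}\Big(\sum_{i\le m}|\xi_i|^2\Big)^{-1/2}$$ for $r<l\le n$, $2\le m\le s$, and, for $1\le k\le s$, $c\in\{2k-1,2k\}$, $m\in J_k$, $$f_{c,m}=N_{k,m}\Big(\sum_{i<m,\,i\ne k}\xi_i\overline{\xi_m}\,|2i-1,2i,c\rangle-\sum_{i<m,\,i\ne k}|\xi_i|^2\,|2m-1,2m,c\rangle\Big),\quad N_{k,m}=\Big(\sum_{i<m,\,i\ne k}|\xi_i|^2\Big)^{-1/2}\Big(\sum_{i\le m,\,i\ne k}|\xi_i|^2\Big)^{-1/2},$$ where $J_1=\{3,\dots,s\}$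 and $J_k=\{2,\dots,s\}\setminus\{k\}$ for $k\ge2$. Let $$K_{0,3}=\sum_{r<j_1<j_2<j_3\le n}P_{j_1,j_2,j_3},\qquad K_{1,2}=\sum_{i=1}^{s}\ \sum_{r<j_1<j_2\le n}\big(P_{2i-1,j_1,j_2}+P_{2i,j_1,j_2}\big),$$ $$K_{2,1}=\sum_{1\le i_1<i_2\le s}\ \sum_{j=r+1}^{n}\ \sum_{a\in\{2i_1-1,2i_1\}}\ \sum_{b\in\{2i_2-1,2i_2\}}P_{a,b,j}+\sum_{l=r+1}^{n}\sum_{m=2}^{s}P_{f_{l,m}},$$ $$K_{3,0}=\sum_{1\le i_1<i_2<i_3\le s}\ \sum_{a\in\{2i_1-1,2i_1\}}\ \sum_{b\in\{2i_2-1,2i_2\}}\ \sum_{c\in\{2i_3-1,2i_3\}}P_{a,b,c}+\sum_{k=1}^{s}\sum_{m\in J_k}\big(P_{f_{2k-1,m}}+P_{f_{2k,m}}\big).$$ Then: 1. $\mathcal H=\mathcal R\oplus\widetilde{\mathcal R}$ and $\mathcal H^{\wedge3}=\widetilde{\mathcal R}^{\wedge3}\oplus(\mathcal R\wedge\widetilde{\mathcal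 R}^{\wedge2})\oplus(\mathcal R^{\wedge2}\wedge\widetilde{\mathcal R})\oplus\mathcal R^{\wedge3}$ are orthogonal direct sums. 2. The orthogonal projection onto $\ker(3P_g\wedge I)$ equals $K_{0,3}+K_{1,2}+K_{2,1}+K_{3,0}$. The four summands are mutually orthogonal projections, namely the orthogonal projections onto the intersections of $\ker(3P_g\wedge I)$ with the four summands of $\mathcal H^{\wedge 3}$ in item 1, in the same order. 3. All the determinants and functions whose projectors occur in $K_{0,3},K_{1,2},K_{2,1},K_{3,0}$ together form an orthonormal basis of $\ker(3P_g\wedge I)$. 4. The ranks of $K_{0,3},K_{1,2},K_{2,1}$ are $\binom{n-2s}{3}$, $2s\binom{n-2s}{2}$ and $4(n-2s)\binom s2+(s-1)(n-2s)$. If $s\ge2$, the rank of $K_{3,0}$ is $8\binom s3+2s(s-2)$ and $\dim\ker(3P_g\wedge I)=\binom n3-n$. If $s=1$, then $K_{3,0}=0$ and $\dim\ker(3P_g\wedge I)=\binom n3-(n-2)$. -/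

import Mathlib

open scoped TensorProduct ComplexConjugate

noncomputable section

namespace Fermion

section Space

variable (H : Type*) [NormedAddCommGroup H] [InnerProductSpace ℂ H]

/-- The two-particle space (distinguishable particles), with the Hilbert tensor inner product. -/
abbrev T2 : Type _ := H ⊗[ℂ] H

/-- The three-particle space (distinguishable particles), with the Hilbert tensor inner product.
It is a type synonym only in order to fix the instances. -/
def T3 : Type _ := (H ⊗[ℂ] H) ⊗[ℂ] H

instance : NormedAddCommGroup (T3 H) := inferInstanceAs (NormedAddCommGroup ((H ⊗[ℂ] H) ⊗[ℂ] H))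

instance : InnerProductSpace ℂ (T3 H) :=
  inferInstanceAs (InnerProductSpace ℂ ((H ⊗[ℂ] H) ⊗[ℂ] H))

instance [FiniteDimensional ℂ H] : FiniteDimensional ℂ (T3 H) :=
  inferInstanceAs (FiniteDimensional ℂ ((H ⊗[ℂ] H) ⊗[ℂ] H))

variable {H} in
/-- The product tensor `a ⊗ b ⊗ c`. -/
def tmul3 (a b c : H) : T3 H := (a ⊗ₜ[ℂ] b) ⊗ₜ[ℂ] c

/-- Exchange of particles 1 and 2 of a two-particle tensor: `a ⊗ b ↦ b ⊗ a`. -/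
def swap : T2 H →ₗ[ℂ] T2 H := (TensorProduct.comm ℂ H H).toLinearMap

/-- The two-particle antisymmetrizer `A² = (1/2!) ∑ sgn(σ) U_σ`. -/
def antisymm2 : T2 H →ₗ[ℂ] T2 H := (1 / 2 : ℂ) • (LinearMap.id - swap H)

variable {H} in
/-- A two-particle operator acting on particles 1 and 2 of three. -/
def on12 (B : T2 H →ₗ[ℂ] T2 H) : T3 H →ₗ[ℂ] T3 H := TensorProduct.map B LinearMap.id

variable {H} in
/-- A two-particle operator acting on particles 2 and 3 of three. -/
def on23 (B : T2 H →ₗ[ℂ] T2 H) : T3 H →ₗ[ℂ] T3 H :=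
  (TensorProduct.assoc ℂ H H H).symm.toLinearMap ∘ₗ TensorProduct.map LinearMap.id B ∘ₗ
    (TensorProduct.assoc ℂ H H H).toLinearMap

variable {H} in
/-- A two-particle operator acting on particles 1 and 3 of three. -/
def on13 (B : T2 H →ₗ[ℂ] T2 H) : T3 H →ₗ[ℂ] T3 H :=
  on23 (swap H) ∘ₗ on12 B ∘ₗ on23 (swap H)

/-- The three-particle antisymmetrizer `A³ = (1/3!) ∑ sgn(σ) U_σ`
(identity, three transpositions, two 3-cycles). -/
def antisymm3 : T3 H →ₗ[ℂ] T3 H :=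
  (1 / 6 : ℂ) • (LinearMap.id
    - on12 (swap H) - on23 (swap H) - on13 (swap H)
    + on12 (swap H) ∘ₗ on23 (swap H) + on23 (swap H) ∘ₗ on12 (swap H))

/-- The three-particle antisymmetric space `H^{∧3}`. -/
abbrev Lambda3 : Submodule ℂ (T3 H) := LinearMap.range (antisymm3 H)

variable {H}

/-- `a ∧ b ∧ c = A³ (a ⊗ b ⊗ c)`. -/
def wedge3 (a b c : H) : Lambda3 H := ⟨antisymm3 H (tmul3 a b c), LinearMap.mem_range_self _ _⟩

/-- `A ∧ B ∧ C`: the subspace of `H^{∧3}` spanned by the `a ∧ b ∧ c`, `a ∈ A`, `b ∈ B`, `c ∈ C`. -/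
def wedgeSpan (A B C : Submodule ℂ H) : Submodule ℂ (Lambda3 H) :=
  Submodule.span ℂ {t | ∃ a ∈ A, ∃ b ∈ B, ∃ c ∈ C, t = wedge3 a b c}

/-- The normalized two-particle determinant `√(2!) a ∧ b`. -/
def ket2 (a b : H) : T2 H := ((√2 : ℝ) : ℂ) • antisymm2 H (a ⊗ₜ[ℂ] b)

/-- The normalized three-particle determinant `√(3!) a ∧ b ∧ c`. -/
def ket3 (a b c : H) : Lambda3 H := ((√6 : ℝ) : ℂ) • wedge3 a b c

variable [FiniteDimensional ℂ H]

/-- The orthogonal projection of the two-particle space onto the line spanned by `g`. -/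
def projOnto2 (g : T2 H) : T2 H →ₗ[ℂ] T2 H := (Submodule.span ℂ {g}).starProjection.toLinearMap

/-- The operator `3 P_g ∧ I = A³ (P_g(1,2) + P_g(1,3) + P_g(2,3)) A³` on `H^{∧3}`. -/
def elemOp (g : T2 H) : Lambda3 H →ₗ[ℂ] Lambda3 H :=
  ((antisymm3 H ∘ₗ (on12 (projOnto2 g) + on13 (projOnto2 g) + on23 (projOnto2 g)) ∘ₗ
    antisymm3 H).codRestrict (Lambda3 H) (fun _ => LinearMap.mem_range_self _ _)).domRestrict
      (Lambda3 H)

/-- The orthogonal projection of `H^{∧3}` onto the line spanned by `f`. -/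
def projOnto3 (f : Lambda3 H) : Lambda3 H →L[ℂ] Lambda3 H :=
  (Submodule.span ℂ {f}).starProjection

end Space

/-! Indices are zero-based: with `i : Fin s`, `slot h i false` is the odd-labelled orbital
`2i - 1` and `slot h i true` the even-labelled orbital `2i` of the one-based numbering. -/

section Indices

/-- The two orbitals of the pair `i`. -/
def slot {n s : ℕ} (h : 2 * s ≤ n) (i : Fin s) (b : Bool) : Fin n :=
  ⟨2 * i.val + b.toNat, by have := i.isLt; cases b <;> simp <;> omega⟩

/-- Orbitals outside the support of `g`: `r < l ≤ n` (one-based). -/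
def outer (n s : ℕ) : Finset (Fin n) := Finset.univ.filter fun l => 2 * s ≤ l.val

/-- `r < j₁ < j₂ ≤ n` (one-based). -/
def outer2 (n s : ℕ) : Finset (Fin n × Fin n) :=
  Finset.univ.filter fun j => 2 * s ≤ j.1.val ∧ j.1 < j.2

/-- `r < j₁ < j₂ < j₃ ≤ n` (one-based). -/
def outer3 (n s : ℕ) : Finset (Fin n × Fin n × Fin n) :=
  Finset.univ.filter fun j => 2 * s ≤ j.1.val ∧ j.1 < j.2.1 ∧ j.2.1 < j.2.2

/-- `i₁ < i₂` among the pairs. -/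
def pairs2 (s : ℕ) : Finset (Fin s × Fin s) := Finset.univ.filter fun i => i.1 < i.2

/-- `i₁ < i₂ < i₃` among the pairs. -/
def pairs3 (s : ℕ) : Finset (Fin s × Fin s × Fin s) :=
  Finset.univ.filter fun i => i.1 < i.2.1 ∧ i.2.1 < i.2.2

/-- `m = 2, …, s` (one-based). -/
def fromSecond (s : ℕ) : Finset (Fin s) := Finset.univ.filter fun m => 1 ≤ m.val

/-- The set `J`: in one-based numbering `{3, …, s}` for `k = 1` and
`{2, …, k - 1, k + 1, …, s}` for `k ≥ 2`. -/
def J {s : ℕ} (k : Fin s) : Finset (Fin s) :=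
  if k.val = 0 then Finset.univ.filter fun m => 2 ≤ m.val
  else Finset.univ.filter fun m => 1 ≤ m.val ∧ m ≠ k

end Indices

section Pieces

variable {H : Type*} [NormedAddCommGroup H] [InnerProductSpace ℂ H]
variable {n s : ℕ} (h : 2 * s ≤ n) (φ : OrthonormalBasis (Fin n) ℂ H) (ξ : Fin s → ℂ)

/-- The determinant `|a, b, c⟩` of three basis orbitals. -/
def det3 (a b c : Fin n) : Lambda3 H := ket3 (φ a) (φ b) (φ c)

/-- `∑ ξ_i |2i-1, 2i⟩`. -/
def geminal : T2 H := ∑ i : Fin s, ξ i • ket2 (φ (slot h i false)) (φ (slot h i true))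

/-- The span `R` of the first `r = 2s` basis orbitals. -/
def R (s : ℕ) : Submodule ℂ H := Submodule.span ℂ {x | ∃ i : Fin n, i.val < 2 * s ∧ x = φ i}

/-- The span `R̃` of the remaining basis orbitals. -/
def Rt (s : ℕ) : Submodule ℂ H := Submodule.span ℂ {x | ∃ i : Fin n, 2 * s ≤ i.val ∧ x = φ i}

/-- The four summands `R̃^{∧3}`, `R ∧ R̃^{∧2}`, `R^{∧2} ∧ R̃`, `R^{∧3}`, in this order. -/
def W (s : ℕ) : Fin 4 → Submodule ℂ (Lambda3 H) :=
  ![wedgeSpan (Rt φ s) (Rt φ s) (Rt φ s), wedgeSpan (R φ s) (Rt φ s) (Rt φ s),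
    wedgeSpan (R φ s) (R φ s) (Rt φ s), wedgeSpan (R φ s) (R φ s) (R φ s)]

/-- The function `f_{l,m}`, `l` outside the support of `g`. -/
def fOuter (l : Fin n) (m : Fin s) : Lambda3 H :=
  (((∑ i with i < m, ‖ξ i‖ ^ 2) ^ (-(1 / 2) : ℝ) * (∑ i with i ≤ m, ‖ξ i‖ ^ 2) ^ (-(1 / 2) : ℝ) :
      ℝ) : ℂ) •
    ((∑ i with i < m, (ξ i * conj (ξ m)) • det3 φ (slot h i false) (slot h i true) l)
      - ((∑ i with i < m, ‖ξ i‖ ^ 2 : ℝ) : ℂ) • det3 φ (slot h m false) (slot h m true) l)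

/-- The functions `f_{2k-1,m}` (`b = false`) and `f_{2k,m}` (`b = true`). -/
def fInner (k : Fin s) (b : Bool) (m : Fin s) : Lambda3 H :=
  (((∑ i with i < m ∧ i ≠ k, ‖ξ i‖ ^ 2) ^ (-(1 / 2) : ℝ) *
      (∑ i with i ≤ m ∧ i ≠ k, ‖ξ i‖ ^ 2) ^ (-(1 / 2) : ℝ) : ℝ) : ℂ) •
    ((∑ i with i < m ∧ i ≠ k,
        (ξ i * conj (ξ m)) • det3 φ (slot h i false) (slot h i true) (slot h k b))
      - ((∑ i with i < m ∧ i ≠ k, ‖ξ i‖ ^ 2 : ℝ) : ℂ) •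
        det3 φ (slot h m false) (slot h m true) (slot h k b))

/-- The determinants appearing in `K_{0,3}`. -/
def v03 : outer3 n s → Lambda3 H := fun j => det3 φ j.1.1 j.1.2.1 j.1.2.2

/-- The determinants appearing in `K_{1,2}`. -/
def v12 : (Fin s × Bool) × outer2 n s → Lambda3 H :=
  fun x => det3 φ (slot h x.1.1 x.1.2) x.2.1.1 x.2.1.2

/-- The determinants and the functions `f_{l,m}` appearing in `K_{2,1}`. -/
def v21 : ((pairs2 s × Bool × Bool) × outer n s) ⊕ (outer n s × fromSecond s) → Lambda3 H :=
  Sum.elim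
    (fun x => det3 φ (slot h x.1.1.1.1 x.1.2.1) (slot h x.1.1.1.2 x.1.2.2) x.2.1)
    (fun x => fOuter h φ ξ x.1.1 x.2.1)

/-- The determinants and the functions `f_{2k-1,m}`, `f_{2k,m}` appearing in `K_{3,0}`. -/
def v30 : (pairs3 s × Bool × Bool × Bool) ⊕ ((k : Fin s) × (Bool × J k)) → Lambda3 H :=
  Sum.elim
    (fun x => det3 φ (slot h x.1.1.1 x.2.1) (slot h x.1.1.2.1 x.2.2.1)
      (slot h x.1.1.2.2 x.2.2.2))
    (fun x => fInner h φ ξ x.1 x.2.1 x.2.2.1)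

/-- All the functions above together. -/
def kerFamily := Sum.elim (v03 (s := s) φ) (Sum.elim (v12 h φ) (Sum.elim (v21 h φ ξ) (v30 h φ ξ)))

variable [FiniteDimensional ℂ H]

/-- The projection `P_{a,b,c}` onto the determinant `|a, b, c⟩`. -/
def P3 (a b c : Fin n) : Lambda3 H →L[ℂ] Lambda3 H := projOnto3 (det3 φ a b c)

/-- `K_{0,3}`. -/
def K03 (s : ℕ) : Lambda3 H →L[ℂ] Lambda3 H := ∑ j ∈ outer3 n s, P3 φ j.1 j.2.1 j.2.2

/-- `K_{1,2}`. -/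
def K12 : Lambda3 H →L[ℂ] Lambda3 H :=
  ∑ i : Fin s, ∑ j ∈ outer2 n s,
    (P3 φ (slot h i false) j.1 j.2 + P3 φ (slot h i true) j.1 j.2)

/-- `K_{2,1}`. -/
def K21 : Lambda3 H →L[ℂ] Lambda3 H :=
  (∑ i ∈ pairs2 s, ∑ j ∈ outer n s,
    (P3 φ (slot h i.1 false) (slot h i.2 false) j + P3 φ (slot h i.1 true) (slot h i.2 true) j
      + P3 φ (slot h i.1 false) (slot h i.2 true) j
      + P3 φ (slot h i.1 true) (slot h i.2 false) j))
  + ∑ l ∈ outer n s, ∑ m ∈ fromSecond s, projOnto3 (fOuter h φ ξ l m)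

/-- `K_{3,0}`. -/
def K30 : Lambda3 H →L[ℂ] Lambda3 H :=
  (∑ i ∈ pairs3 s,
    (P3 φ (slot h i.1 false) (slot h i.2.1 false) (slot h i.2.2 false)
      + P3 φ (slot h i.1 false) (slot h i.2.1 false) (slot h i.2.2 true)
      + P3 φ (slot h i.1 false) (slot h i.2.1 true) (slot h i.2.2 false)
      + P3 φ (slot h i.1 true) (slot h i.2.1 false) (slot h i.2.2 false)
      + P3 φ (slot h i.1 false) (slot h i.2.1 true) (slot h i.2.2 true)
      + P3 φ (slot h i.1 true) (slot h i.2.1 false) (slot h i.2.2 true)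
      + P3 φ (slot h i.1 true) (slot h i.2.1 true) (slot h i.2.2 false)
      + P3 φ (slot h i.1 true) (slot h i.2.1 true) (slot h i.2.2 true)))
  + ∑ k : Fin s, ∑ m ∈ J k,
      (projOnto3 (fInner h φ ξ k false m) + projOnto3 (fInner h φ ξ k true m))

/-- The four pieces `K_{0,3}`, `K_{1,2}`, `K_{2,1}`, `K_{3,0}`, in this order. -/
def K : Fin 4 → (Lambda3 H →L[ℂ] Lambda3 H) := ![K03 φ s, K12 h φ, K21 h φ ξ, K30 h φ ξ]

end Pieces

end Fermion

end

namespace Fermion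

/-! ### Tensors of three particles, antisymmetrization, and signs of determinants -/

section Tensor

variable {H : Type*} [NormedAddCommGroup H] [InnerProductSpace ℂ H]

/-! The operator is positive: on an antisymmetric `ψ` its quadratic form is three times the squared
norm of `P_g(1,2) ψ` (`inner_elemOp`). Hence the kernel consists of the `ψ` orthogonal to every `g ⊗
c`, and it suffices to test `c = φ j`: the kernel is the orthogonal complement of the vectors
`pairSum j = ∑ ξ i |2i-1, 2i, j⟩` (`mem_ker_elemOp_geminal_iff`). These are pairwise orthogonal, and
`pairSum j` is nonzero as soon as some pair avoids `j`. That holds for all `n` orbitals when `s ≥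
2`, but only for the `n - 2` outer ones when `s = 1`, which bounds the dimension of the kernel from
above (`finrank_ker_add_card_le`).

Determinants containing no complete pair are orthogonal to every `pairSum j`. The remaining ones
split into blocks indexed by the extra orbital `j`, and in each block the kernel condition is
orthogonality to the single vector with coefficients `ξ`. The functions `f` are the Gram-Schmidt
solution of that condition: the one at `m` involves only the pairs up to `m` and is orthogonal to
the corresponding truncation of `pairSum j`.

The listed functions are thus an orthonormal family in the kernel, and a binomial identity shows
that their number meets the upper bound, so they span (`span_range_kerFamily`). Each lies in one of
the four mutually orthogonal summands `W`, so the kernel splits along `W` and each `K` projects onto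
its part (`iSup_inf_eq_of_isOrtho`). -/

theorem T3.induction {p : T3 H → Prop} (tmul : ∀ a b c, p (tmul3 a b c))
    (zero : p 0) (add : ∀ x y, p x → p y → p (x + y)) (x : T3 H) : p x := by
  refine TensorProduct.induction_on (motive := p) x zero (fun t c => ?_) add
  refine TensorProduct.induction_on (motive := fun t => p (t ⊗ₜ[ℂ] c : (H ⊗[ℂ] H) ⊗[ℂ] H)) t ?_
    (fun a b => tmul a b c) (fun x y hx hy => ?_)
  · rw [TensorProduct.zero_tmul]; exact zero
  · rw [TensorProduct.add_tmul]; exact add _ _ hx hy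

theorem inner_tmul3 (a b c a' b' c' : H) :
    inner ℂ (tmul3 a b c) (tmul3 a' b' c') = inner ℂ a a' * inner ℂ b b' * inner ℂ c c' := by
  change inner ℂ ((a ⊗ₜ[ℂ] b) ⊗ₜ[ℂ] c : (H ⊗[ℂ] H) ⊗[ℂ] H) ((a' ⊗ₜ[ℂ] b') ⊗ₜ[ℂ] c') = _
  rw [TensorProduct.inner_tmul, TensorProduct.inner_tmul]

theorem T3.hom_ext {M : Type*} [AddCommGroup M] [Module ℂ M] {f g : T3 H →ₗ[ℂ] M}
    (hfg : ∀ a b c, f (tmul3 a b c) = g (tmul3 a b c)) : f = g := by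
  ext x
  exact T3.induction (p := fun x => f x = g x) hfg (by simp) (fun x y hx hy => by simp [hx, hy]) x

theorem T3.isSymmetric {f : T3 H →ₗ[ℂ] T3 H}
    (hf : ∀ a b c a' b' c', inner ℂ (f (tmul3 a b c)) (tmul3 a' b' c') =
      inner ℂ (tmul3 a b c) (f (tmul3 a' b' c'))) : f.IsSymmetric := by
  intro x y
  refine T3.induction (p := fun x => inner ℂ (f x) y = inner ℂ x (f y))
    (fun a b c => ?_) (by simp) (fun x x' hx hx' => ?_) x
  · refine T3.induction (p := fun y => inner ℂ (f (tmul3 a b c)) y = inner ℂ (tmul3 a b c) (f y))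
      (fun a' b' c' => hf _ _ _ _ _ _) (by simp) (fun y y' hy hy' => ?_) y
    simp [hy, hy']
  · simp [hx, hx']

@[simp] theorem on12_swap_tmul3 (a b c : H) : on12 (swap H) (tmul3 a b c) = tmul3 b a c := rfl

@[simp] theorem on23_swap_tmul3 (a b c : H) : on23 (swap H) (tmul3 a b c) = tmul3 a c b := rfl

@[simp] theorem on13_swap_tmul3 (a b c : H) : on13 (swap H) (tmul3 a b c) = tmul3 c b a := rfl

theorem antisymm3_tmul3 (a b c : H) : antisymm3 H (tmul3 a b c) = (1 / 6 : ℂ) •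
    (tmul3 a b c - tmul3 b a c - tmul3 a c b - tmul3 c b a + tmul3 c a b + tmul3 b c a) := by
  simp [antisymm3]

theorem on12_swap_isSymmetric : (on12 (swap H)).IsSymmetric :=
  T3.isSymmetric fun a b c a' b' c' => by
    simp only [on12_swap_tmul3, inner_tmul3]; ring

theorem on23_swap_isSymmetric : (on23 (swap H)).IsSymmetric :=
  T3.isSymmetric fun a b c a' b' c' => by
    simp only [on23_swap_tmul3, inner_tmul3]; ring

theorem antisymm3_isSymmetric : (antisymm3 H).IsSymmetric :=
  T3.isSymmetric fun a b c a' b' c' => by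
    simp only [antisymm3_tmul3, inner_smul_left, inner_smul_right, inner_add_left, inner_sub_left,
      inner_add_right, inner_sub_right, inner_tmul3]
    simp only [map_div₀, map_one, map_ofNat]
    ring

theorem on12_swap_antisymm3 (x : T3 H) : on12 (swap H) (antisymm3 H x) = -antisymm3 H x := by
  have : on12 (swap H) ∘ₗ antisymm3 H = -antisymm3 H := T3.hom_ext fun a b c => by
    simp [antisymm3_tmul3]; module
  exact congr($this x)

theorem on23_swap_antisymm3 (x : T3 H) : on23 (swap H) (antisymm3 H x) = -antisymm3 H x := by
  have : on23 (swap H) ∘ₗ antisymm3 H = -antisymm3 H := T3.hom_ext fun a b c => by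
    simp [antisymm3_tmul3]; module
  exact congr($this x)

theorem antisymm3_antisymm3 (x : T3 H) : antisymm3 H (antisymm3 H x) = antisymm3 H x := by
  have : antisymm3 H ∘ₗ antisymm3 H = antisymm3 H := T3.hom_ext fun a b c => by
    simp [antisymm3_tmul3]; module
  exact congr($this x)

theorem antisymm3_coe (ψ : Lambda3 H) : antisymm3 H (ψ : T3 H) = ψ := by
  obtain ⟨_, x, rfl⟩ := ψ
  exact antisymm3_antisymm3 x

theorem on12_swap_coe (ψ : Lambda3 H) : on12 (swap H) (ψ : T3 H) = -ψ := by
  rw [← antisymm3_coe ψ, on12_swap_antisymm3]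

theorem on23_swap_coe (ψ : Lambda3 H) : on23 (swap H) (ψ : T3 H) = -ψ := by
  rw [← antisymm3_coe ψ, on23_swap_antisymm3]

/-- The antisymmetrizer as a map onto its range. -/
noncomputable def toLambda3 : T3 H →ₗ[ℂ] Lambda3 H := (antisymm3 H).rangeRestrict

@[simp] theorem toLambda3_tmul3 (a b c : H) : toLambda3 (tmul3 a b c) = wedge3 a b c := rfl

/-- The antisymmetrizer is self-adjoint and fixes `ψ`, so it can be dropped from the other factor.
-/
theorem inner_toLambda3 (x : T3 H) (ψ : Lambda3 H) :
    inner ℂ (toLambda3 x) ψ = inner ℂ x (ψ : T3 H) := by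
  change inner ℂ (antisymm3 H x) (ψ : T3 H) = _
  rw [antisymm3_isSymmetric, antisymm3_coe]

theorem inner_wedge3 (a b c a' b' c' : H) :
    inner ℂ (wedge3 a b c) (wedge3 a' b' c') = (1 / 6 : ℂ) *
      (inner ℂ a a' * inner ℂ b b' * inner ℂ c c' - inner ℂ a b' * inner ℂ b a' * inner ℂ c c'
        - inner ℂ a a' * inner ℂ b c' * inner ℂ c b' - inner ℂ a c' * inner ℂ b b' * inner ℂ c a'
        + inner ℂ a c' * inner ℂ b a' * inner ℂ c b'
        + inner ℂ a b' * inner ℂ b c' * inner ℂ c a') := by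
  rw [← toLambda3_tmul3 a b c, inner_toLambda3]
  change inner ℂ _ (antisymm3 H (tmul3 a' b' c')) = _
  simp only [antisymm3_tmul3, inner_smul_right, inner_add_right, inner_sub_right, inner_tmul3]

theorem wedge3_swap12 (a b c : H) : wedge3 a b c = -wedge3 b a c := by
  ext1
  simp only [wedge3, antisymm3_tmul3, Submodule.coe_neg]
  module

theorem wedge3_swap23 (a b c : H) : wedge3 a b c = -wedge3 a c b := by
  ext1
  simp only [wedge3, antisymm3_tmul3, Submodule.coe_neg]
  module

theorem ket3_swap12 (a b c : H) : ket3 a b c = -ket3 b a c := by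
  rw [ket3, wedge3_swap12, smul_neg, ket3]

theorem ket3_swap23 (a b c : H) : ket3 a b c = -ket3 a c b := by
  rw [ket3, wedge3_swap23, smul_neg, ket3]

theorem eq_zero_of_eq_neg {M : Type*} [AddCommGroup M] [Module ℂ M] {x : M} (hx : x = -x) :
    x = 0 := by
  have : (2 : ℂ) • x = 0 := by
    rw [two_smul]
    nth_rw 1 [hx]
    exact neg_add_cancel x
  simpa using this

theorem ket3_self_left (a b : H) : ket3 a a b = 0 :=
  eq_zero_of_eq_neg (ket3_swap12 a a b)

theorem ket3_self_right (a b : H) : ket3 a b b = 0 :=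
  eq_zero_of_eq_neg (ket3_swap23 a b b)

theorem ket3_self_outer (a b : H) : ket3 a b a = 0 := by
  rw [ket3_swap23, ket3_self_left, neg_zero]

/-- The full antisymmetrizer absorbs the two-particle one, and the normalizations differ by `√6 / √2
= √3`. Later only the fact that this scalar is nonzero matters. -/
theorem toLambda3_ket2_tmul (a b c : H) :
    toLambda3 (ket2 a b ⊗ₜ[ℂ] c : (H ⊗[ℂ] H) ⊗[ℂ] H) = ((√3 : ℝ) : ℂ)⁻¹ • ket3 a b c := by
  have h1 : (ket2 a b ⊗ₜ[ℂ] c : (H ⊗[ℂ] H) ⊗[ℂ] H) =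
      (((√2 : ℝ) : ℂ) * (1 / 2)) • (tmul3 a b c - tmul3 b a c : T3 H) := by
    simp only [ket2, antisymm2, swap, LinearMap.smul_apply, LinearMap.sub_apply,
      LinearMap.id_apply, LinearEquiv.coe_coe, TensorProduct.comm_tmul, smul_smul]
    rw [← TensorProduct.smul_tmul', TensorProduct.sub_tmul]
    rfl
  have h6 : √6 = √3 * √2 := by rw [← Real.sqrt_mul (by norm_num)]; norm_num
  have h3 : ((√3 : ℝ) : ℂ) ≠ 0 := by simp
  rw [h1, map_smul, map_sub, toLambda3_tmul3, toLambda3_tmul3, wedge3_swap12 b a c, ket3, h6,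
    smul_smul, Complex.ofReal_mul, inv_mul_cancel_left₀ h3]
  module

end Tensor

/-! ### Positivity of the operator and the description of its kernel by orthogonality -/

section Kernel

variable {H : Type*} [NormedAddCommGroup H] [InnerProductSpace ℂ H]

/-- The tensor `t ⊗ c` of a two-particle and a one-particle vector. -/
def tmul21 (t : T2 H) (c : H) : T3 H := t ⊗ₜ[ℂ] c

theorem on12_tmul3 (B : T2 H →ₗ[ℂ] T2 H) (a b c : H) :
    on12 B (tmul3 a b c) = tmul21 (B (a ⊗ₜ[ℂ] b)) c := rfl

theorem on12_tmul21 (B : T2 H →ₗ[ℂ] T2 H) (t : T2 H) (c : H) :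
    on12 B (tmul21 t c) = tmul21 (B t) c := rfl

theorem inner_tmul21 (t t' : T2 H) (c c' : H) :
    inner ℂ (tmul21 t c) (tmul21 t' c') = inner ℂ t t' * inner ℂ c c' :=
  TensorProduct.inner_tmul ..

theorem tmul21_smul_left (α : ℂ) (t : T2 H) (c : H) : tmul21 (α • t) c = α • tmul21 t c :=
  (TensorProduct.smul_tmul' α t c).symm

theorem on12_isSymmetric {B : T2 H →ₗ[ℂ] T2 H} (hB : B.IsSymmetric) : (on12 B).IsSymmetric :=
  T3.isSymmetric fun a b c a' b' c' => by
    rw [on12_tmul3, on12_tmul3]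
    exact (inner_tmul21 _ _ _ _).trans <| (congrArg (· * inner ℂ c c') (hB _ _)).trans
      (inner_tmul21 _ _ _ _).symm

/-- `on23` is built from the associator while `on13` is a conjugate of `on12`. Conjugating once more
by an exchange brings all three placements back to `on12`. -/
theorem on23_eq (B : T2 H →ₗ[ℂ] T2 H) :
    on23 B = on12 (swap H) ∘ₗ on13 B ∘ₗ on12 (swap H) := by
  refine T3.hom_ext fun a b c => ?_
  have key : ∀ t : T2 H, (TensorProduct.assoc ℂ H H H).symm (a ⊗ₜ[ℂ] t) =
      on12 (swap H) (on23 (swap H) (tmul21 t a)) := fun t => by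
    refine TensorProduct.induction_on t ?_ (fun x y => rfl) (fun x y hx hy => ?_)
    · have : tmul21 (0 : T2 H) a = 0 := TensorProduct.zero_tmul _ _
      simp [this]
      rfl
    · have : tmul21 (x + y) a = tmul21 x a + tmul21 y a := TensorProduct.add_tmul _ _ _
      rw [this, map_add, map_add, ← hx, ← hy, TensorProduct.tmul_add, map_add]
      rfl
  exact key (B (b ⊗ₜ c))

theorem projOnto2_isSymmetric (g : T2 H) : (projOnto2 g).IsSymmetric :=
  Submodule.starProjection_isSymmetric _

theorem projOnto2_self (g : T2 H) : projOnto2 g g = g :=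
  Submodule.starProjection_eq_self_iff.mpr (Submodule.mem_span_singleton_self g)

theorem exists_on12_projOnto2_tmul3 (g : T2 H) (a b c : H) :
    ∃ α : ℂ, on12 (projOnto2 g) (tmul3 a b c) = α • tmul21 g c := by
  obtain ⟨α, hα⟩ := Submodule.mem_span_singleton.mp
    (Submodule.starProjection_apply_mem (Submodule.span ℂ {g}) (a ⊗ₜ[ℂ] b))
  exact ⟨α, by rw [on12_tmul3, ← tmul21_smul_left, hα]; rfl⟩

theorem on12_projOnto2_idem (g : T2 H) (x : T3 H) :
    on12 (projOnto2 g) (on12 (projOnto2 g) x) = on12 (projOnto2 g) x := by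
  have : on12 (projOnto2 g) ∘ₗ on12 (projOnto2 g) = on12 (projOnto2 g) :=
    T3.hom_ext fun a b c => by
      obtain ⟨α, hα⟩ := exists_on12_projOnto2_tmul3 g a b c
      rw [LinearMap.comp_apply, hα, map_smul, on12_tmul21, projOnto2_self]
  exact congr($this x)

theorem coe_elemOp (g : T2 H) (ψ : Lambda3 H) : (elemOp g ψ : T3 H) =
    antisymm3 H (on12 (projOnto2 g) (ψ : T3 H) + on13 (projOnto2 g) (ψ : T3 H)
      + on23 (projOnto2 g) (ψ : T3 H)) := by
  conv_rhs => rw [← antisymm3_coe ψ]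
  rfl

theorem on13_coe (B : T2 H →ₗ[ℂ] T2 H) (ψ : Lambda3 H) :
    on13 B (ψ : T3 H) = -on23 (swap H) (on12 B ψ) := by
  rw [on13, LinearMap.comp_apply, LinearMap.comp_apply, on23_swap_coe, map_neg, map_neg]

theorem on23_coe (B : T2 H →ₗ[ℂ] T2 H) (ψ : Lambda3 H) :
    on23 B (ψ : T3 H) = on12 (swap H) (on23 (swap H) (on12 B ψ)) := by
  rw [on23_eq, LinearMap.comp_apply, LinearMap.comp_apply, on12_swap_coe, map_neg, on13_coe,
    neg_neg]

/-- Placements 13 and 23 are `on12` followed by exchanges, up to sign. Moved to the other side of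
the inner product, the exchanges meet `ψ`, which returns exactly the compensating signs. All three
terms therefore agree, and since `P_g` is a symmetric idempotent each is a squared norm. -/
theorem inner_elemOp (g : T2 H) (ψ : Lambda3 H) :
    inner ℂ ψ (elemOp g ψ) = 3 * inner ℂ (on12 (projOnto2 g) (ψ : T3 H))
      (on12 (projOnto2 g) (ψ : T3 H)) := by
  change inner ℂ (ψ : T3 H) (elemOp g ψ : T3 H) = _
  rw [coe_elemOp, ← antisymm3_isSymmetric, antisymm3_coe, on13_coe, on23_coe, inner_add_right,
    inner_add_right, inner_neg_right, ← on23_swap_isSymmetric, ← on12_swap_isSymmetric,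
    ← on23_swap_isSymmetric, on23_swap_coe, on12_swap_coe, map_neg, on23_swap_coe,
    on12_isSymmetric (projOnto2_isSymmetric g), on12_projOnto2_idem]
  simp only [inner_neg_left, neg_neg]
  ring

theorem elemOp_eq_zero_iff (g : T2 H) (ψ : Lambda3 H) :
    elemOp g ψ = 0 ↔ on12 (projOnto2 g) (ψ : T3 H) = 0 := by
  refine ⟨fun hψ => ?_, fun hψ => ?_⟩
  · have h := inner_elemOp g ψ
    rw [hψ, inner_zero_right] at h
    simpa using h.symm
  · ext1
    rw [coe_elemOp, on13_coe, on23_coe, hψ]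
    simp

/-- `P_g(1,2)` is symmetric, fixes each `g ⊗ c`, and sends each product tensor to a multiple of some
`g ⊗ c`. -/
theorem on12_projOnto2_eq_zero_iff (g : T2 H) (x : T3 H) :
    on12 (projOnto2 g) x = 0 ↔ ∀ c, inner ℂ (tmul21 g c) x = 0 := by
  refine ⟨fun hx c => ?_, fun hx => ?_⟩
  · rw [← projOnto2_self g, ← on12_tmul21, on12_isSymmetric (projOnto2_isSymmetric g), hx,
      inner_zero_right]
  · refine ext_inner_left ℂ fun y => ?_
    rw [inner_zero_right, ← on12_isSymmetric (projOnto2_isSymmetric g)]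
    refine T3.induction (p := fun y => inner ℂ (on12 (projOnto2 g) y) x = 0)
      (fun a b c => ?_) (by simp) (fun y y' hy hy' => ?_) y
    · obtain ⟨α, hα⟩ := exists_on12_projOnto2_tmul3 g a b c
      rw [hα, inner_smul_left, hx, mul_zero]
    · rw [map_add, inner_add_left, hy, hy', add_zero]

theorem mem_ker_elemOp_iff (g : T2 H) (ψ : Lambda3 H) :
    ψ ∈ LinearMap.ker (elemOp g) ↔ ∀ c, inner ℂ (toLambda3 (tmul21 g c)) ψ = 0 := by
  simp only [LinearMap.mem_ker, elemOp_eq_zero_iff, on12_projOnto2_eq_zero_iff, inner_toLambda3]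

end Kernel

/-! ### One explicit Gram-Schmidt step -/

section GramSchmidt

variable {V ι : Type*} [NormedAddCommGroup V] [InnerProductSpace ℂ V] [DecidableEq ι]

/-- The normalization of `(∑ i ∈ I, ξ i * conj (ξ m) • E i) - (∑ i ∈ I, ‖ξ i‖ ^ 2) • E m`, a vector
orthogonal to `∑ i ∈ insert m I, ξ i • E i` when `E` is orthonormal on `insert m I`. -/
noncomputable def gramStep (ξ : ι → ℂ) (E : ι → V) (I : Finset ι) (m : ι) : V :=
  (((∑ i ∈ I, ‖ξ i‖ ^ 2) ^ (-(1 / 2) : ℝ) * (∑ i ∈ insert m I, ‖ξ i‖ ^ 2) ^ (-(1 / 2) : ℝ) :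
      ℝ) : ℂ) •
    ((∑ i ∈ I, (ξ i * conj (ξ m)) • E i) - ((∑ i ∈ I, ‖ξ i‖ ^ 2 : ℝ) : ℂ) • E m)

variable {ξ : ι → ℂ} {E : ι → V} {I : Finset ι} {m : ι}

/-- If the coefficients of `x` along `E` are proportional to `ξ`, the sum over `I` and the term at
`m` both give `β ξ m ∑ ‖ξ i‖ ^ 2` and cancel. The case `β = 0` covers vectors orthogonal to the
block, `β = 1` covers `pairSum`, and a general `β` covers a later Gram-Schmidt vector. -/
theorem inner_gramStep_eq_zero {x : V} (β : ℂ)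
    (hx : ∀ i ∈ insert m I, inner ℂ (E i) x = β * ξ i) : inner ℂ (gramStep ξ E I m) x = 0 := by
  have hI : ∀ i ∈ I, inner ℂ ((ξ i * conj (ξ m)) • E i) x = β * ξ m * ((‖ξ i‖ ^ 2 : ℝ) : ℂ) := by
    intro i hi
    rw [inner_smul_left, hx i (Finset.mem_insert_of_mem hi), map_mul, Complex.conj_conj,
      Complex.ofReal_pow, ← Complex.conj_mul']
    ring
  rw [gramStep, inner_smul_left, inner_sub_left, sum_inner, Finset.sum_congr rfl hI,
    ← Finset.mul_sum, inner_smul_left, hx m (Finset.mem_insert_self _ _), Complex.conj_ofReal,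
    Complex.conj_ofReal, ← Complex.ofReal_sum]
  ring

theorem gramStep_mem {W : Submodule ℂ V} (hE : ∀ i ∈ insert m I, E i ∈ W) :
    gramStep ξ E I m ∈ W :=
  W.smul_mem _ <| W.sub_mem
    (W.sum_mem fun i hi => W.smul_mem _ (hE i (Finset.mem_insert_of_mem hi)))
    (W.smul_mem _ (hE m (Finset.mem_insert_self _ _)))

theorem inner_sum_smul_of_orthonormal {S : Finset ι}
    (hE : ∀ i ∈ S, ∀ j ∈ S, inner ℂ (E i) (E j) = if i = j then 1 else 0) {J : Finset ι}
    (hJ : J ⊆ S) {i : ι} (hi : i ∈ S) (a : ι → ℂ) :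
    inner ℂ (E i) (∑ j ∈ J, a j • E j) = if i ∈ J then a i else 0 := by
  rw [inner_sum, Finset.sum_congr rfl fun j hj => by
    rw [inner_smul_right, hE i hi j (hJ hj), mul_ite, mul_one, mul_zero]]
  exact Finset.sum_ite_eq J i a

/-- Before `m`, the coefficients of the step are themselves proportional to `ξ`. By
`inner_gramStep_eq_zero` this makes earlier steps orthogonal to later ones. -/
theorem inner_gramStep_of_mem
    (hE : ∀ i ∈ insert m I, ∀ j ∈ insert m I, inner ℂ (E i) (E j) = if i = j then 1 else 0)
    (hm : m ∉ I) : ∃ β : ℂ, ∀ i ∈ I, inner ℂ (E i) (gramStep ξ E I m) = β * ξ i := by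
  refine ⟨(((∑ i ∈ I, ‖ξ i‖ ^ 2) ^ (-(1 / 2) : ℝ) *
    (∑ i ∈ insert m I, ‖ξ i‖ ^ 2) ^ (-(1 / 2) : ℝ) : ℝ) : ℂ) * conj (ξ m), fun i hi => ?_⟩
  have hi' := Finset.mem_insert_of_mem (b := m) hi
  rw [gramStep, inner_smul_right, inner_sub_right, inner_smul_right,
    inner_sum_smul_of_orthonormal hE (Finset.subset_insert _ _) hi', if_pos hi,
    hE i hi' m (Finset.mem_insert_self _ _), if_neg (ne_of_mem_of_not_mem hi hm), mul_zero,
    sub_zero, mul_comm (ξ i), ← mul_assoc]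

theorem inner_gramStep_self
    (hE : ∀ i ∈ insert m I, ∀ j ∈ insert m I, inner ℂ (E i) (E j) = if i = j then 1 else 0)
    (hm : m ∉ I) (hI : 0 < ∑ i ∈ I, ‖ξ i‖ ^ 2) :
    inner ℂ (gramStep ξ E I m) (gramStep ξ E I m) = 1 := by
  have hmm := Finset.mem_insert_self m I
  set S := ∑ i ∈ I, ‖ξ i‖ ^ 2 with hS
  have hT : ∑ i ∈ insert m I, ‖ξ i‖ ^ 2 = ‖ξ m‖ ^ 2 + S := Finset.sum_insert hm
  have hTpos : 0 < ‖ξ m‖ ^ 2 + S := by positivity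
  have h1 : ∀ x : ℝ, 0 < x → x ^ (-(1 / 2) : ℝ) * x ^ (-(1 / 2) : ℝ) = x⁻¹ := fun x hx => by
    rw [← Real.rpow_add hx]; norm_num [Real.rpow_neg_one]
  set u := (∑ i ∈ I, (ξ i * conj (ξ m)) • E i) - (S : ℂ) • E m with hu
  have hui : ∀ i ∈ I, inner ℂ (E i) u = ξ i * conj (ξ m) := fun i hi => by
    have hi' := Finset.mem_insert_of_mem (b := m) hi
    rw [hu, inner_sub_right, inner_smul_right,
      inner_sum_smul_of_orthonormal hE (Finset.subset_insert _ _) hi', if_pos hi,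
      hE i hi' m hmm, if_neg (ne_of_mem_of_not_mem hi hm), mul_zero, sub_zero]
  have hum : inner ℂ (E m) u = -S := by
    rw [hu, inner_sub_right, inner_smul_right,
      inner_sum_smul_of_orthonormal hE (Finset.subset_insert _ _) hmm, if_neg hm,
      hE m hmm m hmm, if_pos rfl, mul_one, zero_sub]
  -- The squared norm of the unnormalized vector is `S * ‖ξ m‖ ^ 2 + S ^ 2`, exactly the product of
  -- the two sums whose inverse square roots form the normalization.
  have huu : inner ℂ u u = ((S * (‖ξ m‖ ^ 2 + S) : ℝ) : ℂ) := by
    conv_lhs => rw [hu]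
    rw [← hu, inner_sub_left, sum_inner, inner_smul_left, hum, Complex.conj_ofReal,
      Finset.sum_congr rfl fun i hi => by
        rw [inner_smul_left, hui i hi, map_mul, Complex.conj_conj,
          show conj (ξ i) * ξ m * (ξ i * conj (ξ m)) = (conj (ξ m) * ξ m) * (conj (ξ i) * ξ i) by
            ring, Complex.conj_mul', Complex.conj_mul'],
      ← Finset.mul_sum, hS]
    push_cast
    ring
  rw [gramStep, hT, ← hS, ← hu, inner_smul_left, inner_smul_right, huu, Complex.conj_ofReal,
    ← Complex.ofReal_mul, ← Complex.ofReal_mul, ← Complex.ofReal_one]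
  congr 1
  rw [show ∀ a b c : ℝ, a * b * (a * b * c) = (a * a) * (b * b) * c by intros; ring, h1 _ hI,
    h1 _ hTpos]
  field_simp

end GramSchmidt

/-! ### Orthonormal families and the projections onto their spans -/

section Orthonormal

variable {V ι κ : Type*} [NormedAddCommGroup V] [InnerProductSpace ℂ V]

theorem orthonormal_of_inner {v : ι → V} (h1 : ∀ x, inner ℂ (v x) (v x) = 1)
    (h0 : ∀ x y, inner ℂ (v x) (v y) ≠ 0 → x = y) : Orthonormal ℂ v := by
  classical
  rw [orthonormal_iff_ite]
  intro x y
  split_ifs with hxy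
  · rw [hxy, h1]
  · exact not_not.mp (mt (h0 x y) hxy)

theorem orthonormal_sumElim {v : ι → V} {w : κ → V} (hv : Orthonormal ℂ v) (hw : Orthonormal ℂ w)
    (hvw : ∀ x y, inner ℂ (v x) (w y) = 0) : Orthonormal ℂ (Sum.elim v w) := by
  classical
  rw [orthonormal_iff_ite] at *
  rintro (x | x) (y | y)
  · simp [hv]
  · simp [hvw]
  · simp [inner_eq_zero_symm.mp (hvw y x)]
  · simp [hw]

theorem starProjection_span_range [Fintype ι] [FiniteDimensional ℂ V] {v : ι → V}
    (hv : Orthonormal ℂ v) :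
    (Submodule.span ℂ (Set.range v)).starProjection =
      ∑ i, (Submodule.span ℂ {v i}).starProjection := by
  ext x
  have hsum : (∑ i, (Submodule.span ℂ {v i}).starProjection) x = ∑ i, inner ℂ (v i) x • v i := by
    rw [sum_apply]
    exact Finset.sum_congr rfl fun i _ =>
      Submodule.starProjection_unit_singleton ℂ (hv.norm_eq_one i) x
  rw [hsum]
  refine (Submodule.eq_starProjection_of_mem_of_inner_eq_zero ?_ fun w hw => ?_)
  · exact Submodule.sum_mem _ fun i _ =>
      Submodule.smul_mem _ _ (Submodule.subset_span (Set.mem_range_self i))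
  · induction hw using Submodule.span_induction with
    | mem w hw =>
      obtain ⟨j, rfl⟩ := hw
      rw [inner_sub_left, hv.inner_left_fintype, inner_conj_symm, sub_self]
    | zero => simp
    | add w w' _ _ h h' => rw [inner_add_right, h, h', add_zero]
    | smul c w _ h => rw [inner_smul_right, h, mul_zero]

end Orthonormal

/-! ### Inner products of determinants of basis orbitals -/

section Det

variable {H : Type*} [NormedAddCommGroup H] [InnerProductSpace ℂ H]
variable {n s : ℕ} (φ : OrthonormalBasis (Fin n) ℂ H)

theorem inner_det3 (a b c a' b' c' : Fin n) :
    inner ℂ (det3 φ a b c) (det3 φ a' b' c') =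
      inner ℂ (φ a) (φ a') * inner ℂ (φ b) (φ b') * inner ℂ (φ c) (φ c')
        - inner ℂ (φ a) (φ b') * inner ℂ (φ b) (φ a') * inner ℂ (φ c) (φ c')
        - inner ℂ (φ a) (φ a') * inner ℂ (φ b) (φ c') * inner ℂ (φ c) (φ b')
        - inner ℂ (φ a) (φ c') * inner ℂ (φ b) (φ b') * inner ℂ (φ c) (φ a')
        + inner ℂ (φ a) (φ c') * inner ℂ (φ b) (φ a') * inner ℂ (φ c) (φ b')
        + inner ℂ (φ a) (φ b') * inner ℂ (φ b) (φ c') * inner ℂ (φ c) (φ a') := by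
  have h6 : ((√6 : ℝ) : ℂ) * ((√6 : ℝ) : ℂ) = 6 := by
    rw [← Complex.ofReal_mul, Real.mul_self_sqrt (by norm_num)]; norm_num
  rw [det3, det3, ket3, ket3, inner_smul_left, inner_smul_right, inner_wedge3, Complex.conj_ofReal,
    ← mul_assoc, ← mul_assoc, h6]
  ring

/-- One of the six products in the expansion must survive. This turns every orthogonality question
between determinants into arithmetic of indices. -/
theorem perm_of_inner_det3_ne_zero {a b c a' b' c' : Fin n}
    (hne : inner ℂ (det3 φ a b c) (det3 φ a' b' c') ≠ 0) :
    (a = a' ∧ b = b' ∧ c = c') ∨ (a = b' ∧ b = a' ∧ c = c') ∨ (a = a' ∧ b = c' ∧ c = b') ∨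
      (a = c' ∧ b = b' ∧ c = a') ∨ (a = c' ∧ b = a' ∧ c = b') ∨ (a = b' ∧ b = c' ∧ c = a') := by
  by_contra hcon
  push Not at hcon
  have key : ∀ x y z x' y' z' : Fin n, (x = x' → y = y' → z ≠ z') →
      inner ℂ (φ x) (φ x') * inner ℂ (φ y) (φ y') * inner ℂ (φ z) (φ z') = 0 := by
    intro x y z x' y' z' hxyz
    simp only [φ.inner_eq_ite]
    split_ifs <;> simp_all
  obtain ⟨h1, h2, h3, h4, h5, h6⟩ := hcon
  refine hne ?_
  rw [inner_det3, key _ _ _ _ _ _ h1, key _ _ _ _ _ _ h2, key _ _ _ _ _ _ h3,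
    key _ _ _ _ _ _ h4, key _ _ _ _ _ _ h5, key _ _ _ _ _ _ h6]
  simp

theorem inner_det3_self {a b c : Fin n} (hab : a ≠ b) (hac : a ≠ c) (hbc : b ≠ c) :
    inner ℂ (det3 φ a b c) (det3 φ a b c) = 1 := by
  rw [inner_det3]
  simp [φ.inner_eq_ite, hab, hac, hbc, hab.symm, hac.symm, hbc.symm]

variable (h : 2 * s ≤ n)

@[simp] theorem slot_inj {i i' : Fin s} {b b' : Bool} :
    slot h i b = slot h i' b' ↔ i = i' ∧ b = b' := by
  refine ⟨fun e => ?_, fun e => by rw [e.1, e.2]⟩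
  have e' := congrArg Fin.val e
  simp only [slot] at e'
  cases b <;> cases b' <;> simp only [Bool.toNat_true, Bool.toNat_false] at e' <;>
    (simp [Fin.ext_iff]; omega)

theorem slot_val_lt (i : Fin s) (b : Bool) : (slot h i b).val < 2 * s := by
  have := i.isLt
  cases b <;> (simp only [slot, Bool.toNat_true, Bool.toNat_false]; omega)

theorem slot_ne {i : Fin s} {b : Bool} {l : Fin n} (hl : 2 * s ≤ l.val) : slot h i b ≠ l := by
  rintro rfl
  exact absurd (slot_val_lt h i b) (by omega)

theorem exists_slot_eq {j : Fin n} (hj : j.val < 2 * s) : ∃ i b, j = slot h i b := by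
  refine ⟨⟨j.val / 2, by omega⟩, decide (j.val % 2 = 1), Fin.ext ?_⟩
  rcases Nat.mod_two_eq_zero_or_one j.val with hj | hj <;> simp [slot, hj] <;> omega

/-- The determinant of the pair `i` and the orbital `j`. -/
noncomputable def pairDet (i : Fin s) (j : Fin n) : Lambda3 H :=
  det3 φ (slot h i false) (slot h i true) j

/-- The orbital `j` does not belong to the pair `i`. -/
abbrev OffPair (i : Fin s) (j : Fin n) : Prop := slot h i false ≠ j ∧ slot h i true ≠ j

theorem offPair_outer {i : Fin s} {l : Fin n} (hl : 2 * s ≤ l.val) : OffPair h i l :=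
  ⟨slot_ne h hl, slot_ne h hl⟩

@[simp] theorem offPair_slot {i k : Fin s} {b : Bool} : OffPair h i (slot h k b) ↔ i ≠ k := by
  cases b <;> simp [OffPair]

variable {h}

theorem inner_pairDet_self {i : Fin s} {j : Fin n} (hij : OffPair h i j) :
    inner ℂ (pairDet φ h i j) (pairDet φ h i j) = 1 :=
  inner_det3_self φ (by simp) hij.1 hij.2

theorem offPair_of_pairDet_ne_zero {i : Fin s} {j : Fin n} (hij : pairDet φ h i j ≠ 0) :
    OffPair h i j := by
  refine ⟨?_, ?_⟩ <;> rintro rfl <;> refine hij ?_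
  · exact ket3_self_outer _ _
  · exact ket3_self_right _ _

/-- Pairs are disjoint, so three orbitals cannot contain two different pairs: the set of orbitals
determines the pair and the remaining orbital. -/
theorem eq_of_inner_pairDet_ne_zero {i i' : Fin s} {j j' : Fin n}
    (hne : inner ℂ (pairDet φ h i j) (pairDet φ h i' j') ≠ 0) : i = i' ∧ j = j' := by
  obtain ⟨h1, h2⟩ := offPair_of_pairDet_ne_zero φ (h := h) (i := i) (j := j) fun e =>
    hne (by rw [e, inner_zero_left])
  obtain ⟨h3, h4⟩ := offPair_of_pairDet_ne_zero φ (h := h) (i := i') (j := j') fun e =>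
    hne (by rw [e, inner_zero_right])
  rcases perm_of_inner_det3_ne_zero φ hne with ⟨e1, e2, e3⟩ | ⟨e1, e2, e3⟩ | ⟨e1, e2, e3⟩ |
    ⟨e1, e2, e3⟩ | ⟨e1, e2, e3⟩ | ⟨e1, e2, e3⟩ <;> simp_all [eq_comm]

end Det

/-! ### Determinants span, and the space splits by the number of orbitals in `R` -/

section Decomposition

variable {H : Type*} [NormedAddCommGroup H] [InnerProductSpace ℂ H]
variable {n : ℕ} (φ : OrthonormalBasis (Fin n) ℂ H)

theorem wedge3_mem_of_forall_basis {M : Submodule ℂ (Lambda3 H)} {b c : H}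
    (hM : ∀ i, wedge3 (φ i) b c ∈ M) (a : H) : wedge3 a b c ∈ M := by
  have ha : a ∈ Submodule.span ℂ (Set.range φ) := by
    rw [← φ.coe_toBasis, φ.toBasis.span_eq]; trivial
  induction ha using Submodule.span_induction with
  | mem x hx => obtain ⟨i, rfl⟩ := hx; exact hM i
  | zero =>
    have : tmul3 (0 : H) b c = 0 := by simp only [tmul3, TensorProduct.zero_tmul]; rfl
    rw [← toLambda3_tmul3, this, map_zero]
    exact M.zero_mem
  | add x y _ _ hx hy =>
    have : tmul3 (x + y) b c = tmul3 x b c + tmul3 y b c := by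
      simp only [tmul3, TensorProduct.add_tmul]; rfl
    rw [← toLambda3_tmul3, this, map_add]
    exact M.add_mem hx hy
  | smul α x _ hx =>
    have : tmul3 (α • x) b c = α • tmul3 x b c := by
      simp only [tmul3, ← TensorProduct.smul_tmul']; rfl
    rw [← toLambda3_tmul3, this, map_smul]
    exact M.smul_mem _ hx

theorem eq_top_of_forall_det3_mem {M : Submodule ℂ (Lambda3 H)}
    (hM : ∀ a b c, det3 φ a b c ∈ M) : M = ⊤ := by
  have hw : ∀ a b c, wedge3 (φ a) (φ b) (φ c) ∈ M := fun a b c =>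
    (M.smul_mem_iff (by simp : ((√6 : ℝ) : ℂ) ≠ 0)).mp (hM a b c)
  -- Linearity is available in the first slot only, so transpositions bring the other two arguments
  -- there in turn.
  have hw' : ∀ a b c, wedge3 a b c ∈ M := fun a b c => by
    refine wedge3_mem_of_forall_basis φ (fun i => ?_) a
    rw [wedge3_swap12, M.neg_mem_iff]
    refine wedge3_mem_of_forall_basis φ (fun j => ?_) b
    rw [wedge3_swap23, M.neg_mem_iff, wedge3_swap12, M.neg_mem_iff]
    refine wedge3_mem_of_forall_basis φ (fun k => ?_) c
    exact hw k j i
  refine eq_top_iff.mpr fun ψ _ => ?_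
  obtain ⟨x, hx⟩ := ψ.2
  obtain rfl : toLambda3 x = ψ := Subtype.ext hx
  refine T3.induction (p := fun x => toLambda3 x ∈ M) hw' ?_ (fun x y hx hy => ?_) x
  · rw [map_zero]; exact M.zero_mem
  · rw [map_add]; exact M.add_mem hx hy

theorem det3_mem_iff_swap12 {M : Submodule ℂ (Lambda3 H)} {a b c : Fin n} :
    det3 φ a b c ∈ M ↔ det3 φ b a c ∈ M := by
  rw [det3, ket3_swap12, M.neg_mem_iff, det3]

theorem det3_mem_iff_swap23 {M : Submodule ℂ (Lambda3 H)} {a b c : Fin n} :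
    det3 φ a b c ∈ M ↔ det3 φ a c b ∈ M := by
  rw [det3, ket3_swap23, M.neg_mem_iff, det3]

/-- For `s = 0` every orbital is outer, so this family runs over all strictly increasing triples. -/
theorem span_range_v03_zero : Submodule.span ℂ (Set.range (v03 (s := 0) φ)) = ⊤ := by
  refine eq_top_of_forall_det3_mem φ fun a b c => ?_
  set M := Submodule.span ℂ (Set.range (v03 (s := 0) φ))
  have hlt : ∀ a b c : Fin n, a < b → b < c → det3 φ a b c ∈ M := fun a b c hab hbc =>
    Submodule.subset_span ⟨⟨(a, b, c), by simp [outer3, hab, hbc]⟩, rfl⟩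
  have hle : ∀ a b c : Fin n, a ≤ b → b ≤ c → det3 φ a b c ∈ M := fun a b c hab hbc => by
    rcases hab.lt_or_eq with hab | rfl
    · rcases hbc.lt_or_eq with hbc | rfl
      · exact hlt a b c hab hbc
      · rw [det3, ket3_self_right]; exact M.zero_mem
    · rw [det3, ket3_self_left]; exact M.zero_mem
  rcases le_total a b with hab | hab <;> rcases le_total b c with hbc | hbc <;>
    rcases le_total a c with hac | hac
  · exact hle _ _ _ hab hbc
  · exact hle _ _ _ hab hbc
  · exact (det3_mem_iff_swap23 φ).mpr (hle _ _ _ hac hbc)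
  · exact (det3_mem_iff_swap23 φ).mpr ((det3_mem_iff_swap12 φ).mpr (hle _ _ _ hac hab))
  · exact (det3_mem_iff_swap12 φ).mpr (hle _ _ _ hab hac)
  · exact (det3_mem_iff_swap12 φ).mpr ((det3_mem_iff_swap23 φ).mpr (hle _ _ _ hbc hac))
  · exact (det3_mem_iff_swap12 φ).mpr (hle _ _ _ hab hac)
  · exact (det3_mem_iff_swap12 φ).mpr ((det3_mem_iff_swap23 φ).mpr
      ((det3_mem_iff_swap12 φ).mpr (hle _ _ _ hbc hab)))

variable (s : ℕ)

theorem R_isOrtho_Rt : R φ s ⟂ Rt φ s := by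
  refine Submodule.isOrtho_span.mpr ?_
  rintro _ ⟨i, hi, rfl⟩ _ ⟨j, hj, rfl⟩
  rw [φ.inner_eq_ite, if_neg (by rintro rfl; omega)]

theorem isCompl_R_Rt : IsCompl (R φ s) (Rt φ s) := by
  refine ⟨(R_isOrtho_Rt φ s).disjoint, codisjoint_iff.mpr (eq_top_iff.mpr ?_)⟩
  rw [← φ.toBasis.span_eq, φ.coe_toBasis, Submodule.span_le]
  rintro _ ⟨i, rfl⟩
  rcases lt_or_ge i.val (2 * s) with hi | hi
  · exact Submodule.mem_sup_left (Submodule.subset_span ⟨i, hi, rfl⟩)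
  · exact Submodule.mem_sup_right (Submodule.subset_span ⟨i, hi, rfl⟩)

theorem inner_eq_zero_of_mem_R_of_mem_Rt {s : ℕ} {x y : H} (hx : x ∈ R φ s) (hy : y ∈ Rt φ s) :
    inner ℂ x y = 0 :=
  Submodule.isOrtho_iff_inner_eq.mp (R_isOrtho_Rt φ s) x hx y hy

theorem inner_eq_zero_of_mem_Rt_of_mem_R {s : ℕ} {x y : H} (hx : x ∈ Rt φ s) (hy : y ∈ R φ s) :
    inner ℂ x y = 0 :=
  inner_eq_zero_symm.mp (inner_eq_zero_of_mem_R_of_mem_Rt φ hy hx)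

/-- Two wedges from different summands have different numbers of factors in `R`, so each of the six
products in their inner product pairs a vector of `R` with one of `Rt`. -/
theorem W_pairwise_isOrtho : Pairwise fun a b => W φ s a ⟂ W φ s b := by
  intro a b hab
  fin_cases a <;> fin_cases b <;> first | exact absurd rfl hab | skip
  all_goals
    refine Submodule.isOrtho_span.mpr ?_
    rintro _ ⟨a, ha, b, hb, c, hc, rfl⟩ _ ⟨a', ha', b', hb', c', hc', rfl⟩
    rw [inner_wedge3]
    simp [inner_eq_zero_of_mem_R_of_mem_Rt φ (s := s),
      inner_eq_zero_of_mem_Rt_of_mem_R φ (s := s), *]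

variable {s}

theorem basis_mem_R {i : Fin n} (hi : i.val < 2 * s) : φ i ∈ R φ s :=
  Submodule.subset_span ⟨i, hi, rfl⟩

theorem basis_mem_Rt {i : Fin n} (hi : 2 * s ≤ i.val) : φ i ∈ Rt φ s :=
  Submodule.subset_span ⟨i, hi, rfl⟩

theorem ket3_mem_wedgeSpan {A B C : Submodule ℂ H} {a b c : H} (ha : a ∈ A) (hb : b ∈ B)
    (hc : c ∈ C) : ket3 a b c ∈ wedgeSpan A B C :=
  Submodule.smul_mem _ _ (Submodule.subset_span ⟨a, ha, b, hb, c, hc, rfl⟩)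

variable {a b c : Fin n}

theorem det3_mem_W_zero (ha : 2 * s ≤ a.val) (hb : 2 * s ≤ b.val) (hc : 2 * s ≤ c.val) :
    det3 φ a b c ∈ W φ s 0 :=
  ket3_mem_wedgeSpan (basis_mem_Rt φ ha) (basis_mem_Rt φ hb) (basis_mem_Rt φ hc)

theorem det3_mem_W_one (ha : a.val < 2 * s) (hb : 2 * s ≤ b.val) (hc : 2 * s ≤ c.val) :
    det3 φ a b c ∈ W φ s 1 :=
  ket3_mem_wedgeSpan (basis_mem_R φ ha) (basis_mem_Rt φ hb) (basis_mem_Rt φ hc)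

theorem det3_mem_W_two (ha : a.val < 2 * s) (hb : b.val < 2 * s) (hc : 2 * s ≤ c.val) :
    det3 φ a b c ∈ W φ s 2 :=
  ket3_mem_wedgeSpan (basis_mem_R φ ha) (basis_mem_R φ hb) (basis_mem_Rt φ hc)

theorem det3_mem_W_three (ha : a.val < 2 * s) (hb : b.val < 2 * s) (hc : c.val < 2 * s) :
    det3 φ a b c ∈ W φ s 3 :=
  ket3_mem_wedgeSpan (basis_mem_R φ ha) (basis_mem_R φ hb) (basis_mem_R φ hc)

variable (s)

theorem iSup_W : ⨆ i, W φ s i = ⊤ := by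
  refine eq_top_of_forall_det3_mem φ fun a b c => ?_
  have hW : ∀ i {ψ}, ψ ∈ W φ s i → ψ ∈ ⨆ i, W φ s i := fun i ψ hψ => Submodule.mem_iSup_of_mem i hψ
  rcases lt_or_ge a.val (2 * s) with ha | ha <;> rcases lt_or_ge b.val (2 * s) with hb | hb <;>
    rcases lt_or_ge c.val (2 * s) with hc | hc
  · exact hW 3 (det3_mem_W_three φ ha hb hc)
  · exact hW 2 (det3_mem_W_two φ ha hb hc)
  · exact (det3_mem_iff_swap23 φ).mpr (hW 2 (det3_mem_W_two φ ha hc hb))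
  · exact hW 1 (det3_mem_W_one φ ha hb hc)
  · exact (det3_mem_iff_swap12 φ).mpr ((det3_mem_iff_swap23 φ).mpr
      (hW 2 (det3_mem_W_two φ hb hc ha)))
  · exact (det3_mem_iff_swap12 φ).mpr (hW 1 (det3_mem_W_one φ hb ha hc))
  · exact (det3_mem_iff_swap23 φ).mpr ((det3_mem_iff_swap12 φ).mpr
      (hW 1 (det3_mem_W_one φ hc ha hb)))
  · exact hW 0 (det3_mem_W_zero φ ha hb hc)

theorem W_isInternal [FiniteDimensional ℂ H] : DirectSum.IsInternal (W φ s) := by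
  have hort : OrthogonalFamily ℂ (fun i => W φ s i) fun i => (W φ s i).subtypeₗᵢ :=
    OrthogonalFamily.of_pairwise (W_pairwise_isOrtho φ s)
  rw [hort.isInternal_iff, iSup_W, Submodule.top_orthogonal_eq_bot]

end Decomposition

/-! ### Cardinalities of the index sets -/

section Cards

variable {α : Type*} [LinearOrder α] [Fintype α]

theorem card_increasing_pairs (S : Finset α) :
    (Finset.univ.filter fun p : α × α => p.1 ∈ S ∧ p.2 ∈ S ∧ p.1 < p.2).card =
      S.card.choose 2 := by
  induction S using Finset.induction_on_max with
  | empty => simp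
  | insert m S hS ih =>
    have hm : m ∉ S := fun hm => lt_irrefl _ (hS m hm)
    have : (Finset.univ.filter fun p : α × α =>
        p.1 ∈ insert m S ∧ p.2 ∈ insert m S ∧ p.1 < p.2) =
        S.image (fun a => (a, m)) ∪
          Finset.univ.filter fun p : α × α => p.1 ∈ S ∧ p.2 ∈ S ∧ p.1 < p.2 := by
      ext ⟨a, b⟩
      simp only [Finset.mem_filter, Finset.mem_univ, true_and, Finset.mem_insert,
        Finset.mem_union, Finset.mem_image, Prod.mk.injEq]
      have := hS a
      have := hS b
      grind
    rw [this, Finset.card_union_of_disjoint, ih, Finset.card_insert_of_notMem hm,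
      Finset.card_image_of_injective _ (Prod.mk_left_injective m),
      Nat.choose_succ_succ' S.card 1, Nat.choose_one_right]
    rw [Finset.disjoint_left]
    simp only [Finset.mem_image, Finset.mem_filter]
    rintro _ ⟨a, -, rfl⟩ ⟨-, -, hm', -⟩
    exact hm hm'

/-- Adjoining a new maximum `m` creates exactly the triples ending in `m`, one for each increasing
pair of the old set: Pascal's rule. -/
theorem card_increasing_triples (S : Finset α) :
    (Finset.univ.filter fun p : α × α × α =>
      p.1 ∈ S ∧ p.2.1 ∈ S ∧ p.2.2 ∈ S ∧ p.1 < p.2.1 ∧ p.2.1 < p.2.2).card = S.card.choose 3 := by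
  induction S using Finset.induction_on_max with
  | empty => simp
  | insert m S hS ih =>
    have hm : m ∉ S := fun hm => lt_irrefl _ (hS m hm)
    have : (Finset.univ.filter fun p : α × α × α => p.1 ∈ insert m S ∧ p.2.1 ∈ insert m S ∧
          p.2.2 ∈ insert m S ∧ p.1 < p.2.1 ∧ p.2.1 < p.2.2) =
        (Finset.univ.filter fun p : α × α => p.1 ∈ S ∧ p.2 ∈ S ∧ p.1 < p.2).image
          (fun p => (p.1, p.2, m)) ∪
          Finset.univ.filter fun p : α × α × α =>
            p.1 ∈ S ∧ p.2.1 ∈ S ∧ p.2.2 ∈ S ∧ p.1 < p.2.1 ∧ p.2.1 < p.2.2 := by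
      ext ⟨a, b, c⟩
      simp only [Finset.mem_filter, Finset.mem_univ, true_and, Finset.mem_insert,
        Finset.mem_union, Finset.mem_image, Prod.mk.injEq, Prod.exists]
      constructor
      · rintro ⟨ha, hb, hc, hab, hbc⟩
        have hcm : c ≤ m := hc.elim (fun e => e.le) fun e => (hS c e).le
        have hb' : b ∈ S := hb.resolve_left (hbc.trans_le hcm).ne
        have ha' : a ∈ S := ha.resolve_left ((hab.trans hbc).trans_le hcm).ne
        rcases hc with rfl | hc
        · exact Or.inl ⟨a, b, ⟨ha', hb', hab⟩, rfl, rfl, rfl⟩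
        · exact Or.inr ⟨ha', hb', hc, hab, hbc⟩
      · rintro (⟨a, b, ⟨ha, hb, hab⟩, rfl, rfl, rfl⟩ | ⟨ha, hb, hc, hab, hbc⟩)
        · exact ⟨Or.inr ha, Or.inr hb, Or.inl rfl, hab, hS b hb⟩
        · exact ⟨Or.inr ha, Or.inr hb, Or.inr hc, hab, hbc⟩
    rw [this, Finset.card_union_of_disjoint, ih, Finset.card_insert_of_notMem hm,
      Finset.card_image_of_injective, Nat.choose_succ_succ' S.card 2, card_increasing_pairs]
    · rintro ⟨a, b⟩ ⟨a', b'⟩ hab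
      simpa using hab
    · rw [Finset.disjoint_left]
      simp only [Finset.mem_image, Finset.mem_filter]
      rintro _ ⟨a, -, rfl⟩ ⟨-, -, -, hm', -⟩
      exact hm hm'

variable (n s : ℕ)

theorem card_outer : (outer n s).card = n - 2 * s := by
  have : (outer n s).map Fin.valEmbedding = Finset.Ico (2 * s) n := by
    ext x
    simp only [outer, Finset.mem_map, Finset.mem_filter, Finset.mem_univ, true_and,
      Fin.valEmbedding_apply, Finset.mem_Ico]
    exact ⟨fun ⟨l, hl, e⟩ => e ▸ ⟨hl, l.isLt⟩, fun hx => ⟨⟨x, hx.2⟩, hx.1, rfl⟩⟩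
  rw [← Finset.card_map, this, Nat.card_Ico]

theorem card_outer2 : (outer2 n s).card = (n - 2 * s).choose 2 := by
  rw [← card_outer, ← card_increasing_pairs]
  congr 1
  ext ⟨a, b⟩
  simp only [outer2, outer, Finset.mem_filter, Finset.mem_univ, true_and, Fin.lt_def]
  omega

theorem card_outer3 : (outer3 n s).card = (n - 2 * s).choose 3 := by
  rw [← card_outer, ← card_increasing_triples]
  congr 1
  ext ⟨a, b, c⟩
  simp only [outer3, outer, Finset.mem_filter, Finset.mem_univ, true_and, Fin.lt_def]
  omega

theorem card_pairs2 : (pairs2 s).card = s.choose 2 := by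
  conv_rhs => rw [← Finset.card_fin s, ← card_increasing_pairs]
  simp [pairs2]

theorem card_pairs3 : (pairs3 s).card = s.choose 3 := by
  conv_rhs => rw [← Finset.card_fin s, ← card_increasing_triples]
  simp [pairs3]

theorem card_fromSecond : (fromSecond s).card = s - 1 := by
  cases s with
  | zero => rfl
  | succ s =>
    have : fromSecond (s + 1) = Finset.univ.erase 0 := by
      ext m
      simp only [fromSecond, Finset.mem_filter, Finset.mem_univ, true_and, Finset.mem_erase,
        and_true, ne_eq, Fin.ext_iff, Fin.val_zero]
      omega
    rw [this, Finset.card_erase_of_mem (Finset.mem_univ _), Finset.card_fin]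

variable {s}

theorem card_J (k : Fin s) : (J k).card = s - 2 := by
  obtain _ | _ | s := s
  · exact k.elim0
  · have : J k = ∅ := by
      ext m
      simp [J]
    simp [this]
  -- Both cases of the definition remove `k` and the smallest index other than `k`; for `k = 0` the
  -- latter is `1`.
  · have : J k = (Finset.univ.erase 0).erase (if k = 0 then 1 else k) := by
      ext m
      simp only [J, Finset.mem_erase, Finset.mem_univ, and_true, Fin.ext_iff, Fin.val_zero, ne_eq]
      have h1 : (1 : Fin (s + 2)).val = 1 := rfl
      split_ifs <;> simp only [Finset.mem_filter, Finset.mem_univ, true_and] <;> omega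
    rw [this, Finset.card_erase_of_mem, Finset.card_erase_of_mem (Finset.mem_univ _),
      Finset.card_fin]
    · omega
    · rw [Finset.mem_erase]
      refine ⟨?_, Finset.mem_univ _⟩
      split_ifs with hk
      · simp
      · exact hk

theorem cast_choose_three (n : ℕ) : (n.choose 3 : ℚ) = n * (n - 1) * (n - 2) / 6 := by
  induction n with
  | zero => simp
  | succ n ih =>
    rw [Nat.choose_succ_succ' n 2]
    push_cast
    rw [ih, Nat.cast_choose_two]
    ring

end Cards

/-! ### The listed functions: membership in the kernel and orthonormality -/

section Families

variable {H : Type*} [NormedAddCommGroup H] [InnerProductSpace ℂ H]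
variable {n s : ℕ} (h : 2 * s ≤ n) (φ : OrthonormalBasis (Fin n) ℂ H) (ξ : Fin s → ℂ)

theorem slot_val (i : Fin s) (b : Bool) : (slot h i b).val = 2 * i.val + b.toNat := rfl

/-- The vector `∑ ξ i • |2i-1, 2i, j⟩`, proportional to `g ∧ φ j`. -/
noncomputable def pairSum (j : Fin n) : Lambda3 H := ∑ i, ξ i • pairDet φ h i j

theorem toLambda3_geminal (j : Fin n) :
    toLambda3 (tmul21 (geminal h φ ξ) (φ j)) = ((√3 : ℝ) : ℂ)⁻¹ • pairSum h φ ξ j := by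
  have : tmul21 (geminal h φ ξ) (φ j) =
      ∑ i, ξ i • tmul21 (ket2 (φ (slot h i false)) (φ (slot h i true))) (φ j) := by
    simp only [← tmul21_smul_left]
    exact TensorProduct.sum_tmul ..
  rw [this, map_sum, pairSum, Finset.smul_sum]
  refine Finset.sum_congr rfl fun i _ => ?_
  rw [map_smul, smul_comm]
  exact congrArg _ (toLambda3_ket2_tmul _ _ _)

/-- Expanding `c` in the basis reduces the condition for all `c` to finitely many vectors, since `g
∧ φ j` is a nonzero multiple of `pairSum j`. -/
theorem mem_ker_elemOp_geminal_iff (ψ : Lambda3 H) :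
    ψ ∈ LinearMap.ker (elemOp (geminal h φ ξ)) ↔ ∀ j, inner ℂ (pairSum h φ ξ j) ψ = 0 := by
  have hj : ∀ j, inner ℂ (toLambda3 (tmul21 (geminal h φ ξ) (φ j))) ψ = 0 ↔
      inner ℂ (pairSum h φ ξ j) ψ = 0 := fun j => by
    rw [toLambda3_geminal, inner_smul_left]
    simp
  rw [mem_ker_elemOp_iff]
  refine ⟨fun hψ j => (hj j).mp (hψ _), fun hψ c => ?_⟩
  have : tmul21 (geminal h φ ξ) c =
      ∑ j, inner ℂ (φ j) c • tmul21 (geminal h φ ξ) (φ j) := by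
    conv_lhs => rw [← φ.sum_repr' c]
    exact (TensorProduct.tmul_sum ..).trans
      (Finset.sum_congr rfl fun j _ => TensorProduct.tmul_smul ..)
  rw [this, map_sum, sum_inner]
  refine Finset.sum_eq_zero fun j _ => ?_
  rw [map_smul, inner_smul_left, (hj j).mpr (hψ j), mul_zero]

theorem mem_ker_of_pairFree {ψ : Lambda3 H} (hψ : ∀ i j, inner ℂ (pairDet φ h i j) ψ = 0) :
    ψ ∈ LinearMap.ker (elemOp (geminal h φ ξ)) := by
  refine (mem_ker_elemOp_geminal_iff h φ ξ ψ).mpr fun j => ?_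
  rw [pairSum, sum_inner]
  exact Finset.sum_eq_zero fun i _ => by rw [inner_smul_left, hψ, mul_zero]

variable {h}

theorem inner_pairDet_of_ne {i i' : Fin s} {j j' : Fin n} (hne : ¬(i = i' ∧ j = j')) :
    inner ℂ (pairDet φ h i j) (pairDet φ h i' j') = 0 :=
  not_not.mp (mt (eq_of_inner_pairDet_ne_zero φ) hne)

theorem inner_pairDet_pairSum_self {i : Fin s} {j : Fin n} (hij : OffPair h i j) :
    inner ℂ (pairDet φ h i j) (pairSum h φ ξ j) = ξ i := by
  rw [pairSum, inner_sum, Finset.sum_eq_single i]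
  · rw [inner_smul_right, inner_pairDet_self φ hij, mul_one]
  · intro i' _ hi'
    rw [inner_smul_right, inner_pairDet_of_ne φ fun e => hi' e.1.symm, mul_zero]
  · simp

theorem inner_pairDet_pairSum_of_ne {i : Fin s} {j j' : Fin n} (hj : j ≠ j') :
    inner ℂ (pairDet φ h i j) (pairSum h φ ξ j') = 0 := by
  rw [pairSum, inner_sum]
  exact Finset.sum_eq_zero fun i' _ => by
    rw [inner_smul_right, inner_pairDet_of_ne φ fun e => hj e.2, mul_zero]

theorem inner_pairSum_of_ne {j j' : Fin n} (hj : j ≠ j') :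
    inner ℂ (pairSum h φ ξ j) (pairSum h φ ξ j') = 0 := by
  rw [pairSum, sum_inner]
  exact Finset.sum_eq_zero fun i _ => by
    rw [inner_smul_left, inner_pairDet_pairSum_of_ne φ ξ hj, mul_zero]

theorem pairSum_ne_zero (hξ : ∀ i, ξ i ≠ 0) {i : Fin s} {j : Fin n} (hij : OffPair h i j) :
    pairSum h φ ξ j ≠ 0 := fun e =>
  hξ i (by rw [← inner_pairDet_pairSum_self φ ξ hij, e, inner_zero_right])

variable (h)

/-- The common form of the functions `f_{l,m}` and `f_{c,m}`. -/
noncomputable def pairGram (j : Fin n) (m : Fin s) : Lambda3 H :=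
  gramStep ξ (fun i => pairDet φ h i j) {i | i < m ∧ OffPair h i j} m

theorem fOuter_eq_pairGram {l : Fin n} (hl : 2 * s ≤ l.val) (m : Fin s) :
    fOuter h φ ξ l m = pairGram h φ ξ l m := by
  have h1 : (Finset.univ.filter fun i => i < m ∧ OffPair h i l) =
      Finset.univ.filter fun i => i < m :=
    Finset.filter_congr fun i _ => and_iff_left (offPair_outer h hl)
  have h2 : insert m (Finset.univ.filter fun i => i < m) = Finset.univ.filter fun i => i ≤ m := by
    ext i
    simp [le_iff_eq_or_lt]
  rw [pairGram, gramStep, h1, h2]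
  rfl

theorem fInner_eq_pairGram {k m : Fin s} (hm : m ≠ k) (b : Bool) :
    fInner h φ ξ k b m = pairGram h φ ξ (slot h k b) m := by
  have h1 : (Finset.univ.filter fun i => i < m ∧ OffPair h i (slot h k b)) =
      Finset.univ.filter fun i => i < m ∧ i ≠ k :=
    Finset.filter_congr fun i _ => by rw [offPair_slot]
  have h2 : insert m (Finset.univ.filter fun i => i < m ∧ i ≠ k) =
      Finset.univ.filter fun i => i ≤ m ∧ i ≠ k := by
    ext i
    simp only [Finset.mem_insert, Finset.mem_filter, Finset.mem_univ, true_and, le_iff_eq_or_lt]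
    constructor
    · rintro (rfl | ⟨hi, hk⟩)
      · exact ⟨Or.inl rfl, hm⟩
      · exact ⟨Or.inr hi, hk⟩
    · rintro ⟨rfl | hi, hk⟩
      · exact Or.inl rfl
      · exact Or.inr ⟨hi, hk⟩
  rw [pairGram, gramStep, h1, h2]
  rfl

theorem inner_pairGram_of_pairFree {ψ : Lambda3 H} (hψ : ∀ i j, inner ℂ (pairDet φ h i j) ψ = 0)
    (j : Fin n) (m : Fin s) : inner ℂ (pairGram h φ ξ j m) ψ = 0 :=
  inner_gramStep_eq_zero 0 fun i _ => by rw [hψ, zero_mul]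

theorem inner_pairDet_pairGram_of_ne {i : Fin s} {j j' : Fin n} (hj : j ≠ j') (m : Fin s) :
    inner ℂ (pairDet φ h i j) (pairGram h φ ξ j' m) = 0 :=
  inner_eq_zero_symm.mp <| inner_gramStep_eq_zero 0 fun i' _ => by
    rw [inner_pairDet_of_ne φ fun e => hj e.2.symm, zero_mul]

theorem inner_pairGram_of_ne {j j' : Fin n} (hj : j ≠ j') (m m' : Fin s) :
    inner ℂ (pairGram h φ ξ j m) (pairGram h φ ξ j' m') = 0 :=
  inner_gramStep_eq_zero 0 fun i _ => by rw [inner_pairDet_pairGram_of_ne h φ ξ hj, zero_mul]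

variable {h}

theorem offPair_of_mem_insert {j : Fin n} {m : Fin s} (hmj : OffPair h m j) {i : Fin s}
    (hi : i ∈ insert m (Finset.univ.filter fun i => i < m ∧ OffPair h i j)) :
    i ≤ m ∧ OffPair h i j := by
  rcases Finset.mem_insert.mp hi with rfl | hi
  · exact ⟨le_rfl, hmj⟩
  · exact ⟨(Finset.mem_filter.mp hi).2.1.le, (Finset.mem_filter.mp hi).2.2⟩

theorem inner_pairDet_eq_ite {j : Fin n} {m : Fin s} (hmj : OffPair h m j) :
    ∀ i ∈ insert m (Finset.univ.filter fun i => i < m ∧ OffPair h i j),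
      ∀ i' ∈ insert m (Finset.univ.filter fun i => i < m ∧ OffPair h i j),
        inner ℂ (pairDet φ h i j) (pairDet φ h i' j) = if i = i' then 1 else 0 := by
  intro i hi i' _
  split_ifs with hii
  · rw [← hii, inner_pairDet_self φ (offPair_of_mem_insert hmj hi).2]
  · exact inner_pairDet_of_ne φ fun e => hii e.1

/-- The earlier admissible pair `i` keeps the first normalizing sum positive. This is why the
smallest admissible `m` is left out of the index sets. -/
theorem inner_pairGram_self (hξ : ∀ i, ξ i ≠ 0) {j : Fin n} {m i : Fin s} (hmj : OffPair h m j)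
    (him : i < m) (hij : OffPair h i j) :
    inner ℂ (pairGram h φ ξ j m) (pairGram h φ ξ j m) = 1 := by
  refine inner_gramStep_self (inner_pairDet_eq_ite φ hmj) (by simp) ?_
  refine Finset.sum_pos (fun i _ => by have := norm_pos_iff.mpr (hξ i); positivity) ⟨i, ?_⟩
  simpa using ⟨him, hij⟩

/-- All pairs occurring in the vector at `m` are among those strictly before `m'`, where the vector
at `m'` has coefficients proportional to `ξ`. -/
theorem inner_pairGram_of_lt {j : Fin n} {m m' : Fin s} (hmj : OffPair h m j)
    (hmj' : OffPair h m' j) (hm : m < m') :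
    inner ℂ (pairGram h φ ξ j m) (pairGram h φ ξ j m') = 0 := by
  obtain ⟨β, hβ⟩ := inner_gramStep_of_mem (ξ := ξ) (inner_pairDet_eq_ite φ hmj') (by simp)
  refine inner_gramStep_eq_zero β fun i hi => hβ i ?_
  obtain ⟨him, hij⟩ := offPair_of_mem_insert hmj hi
  simpa using ⟨him.trans_lt hm, hij⟩

theorem eq_of_inner_pairGram_ne_zero {j j' : Fin n} {m m' : Fin s} (hmj : OffPair h m j)
    (hmj' : OffPair h m' j')
    (hne : inner ℂ (pairGram h φ ξ j m) (pairGram h φ ξ j' m') ≠ 0) : j = j' ∧ m = m' := by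
  obtain rfl : j = j' := by
    by_contra hj
    exact hne (inner_pairGram_of_ne h φ ξ hj m m')
  refine ⟨rfl, ?_⟩
  rcases lt_trichotomy m m' with hm | hm | hm
  · exact absurd (inner_pairGram_of_lt φ ξ hmj hmj' hm) hne
  · exact hm
  · exact absurd (inner_eq_zero_symm.mp (inner_pairGram_of_lt φ ξ hmj' hmj hm)) hne

theorem pairGram_mem_ker {j : Fin n} {m : Fin s} (hmj : OffPair h m j) :
    pairGram h φ ξ j m ∈ LinearMap.ker (elemOp (geminal h φ ξ)) := by
  refine (mem_ker_elemOp_geminal_iff h φ ξ _).mpr fun j' => inner_eq_zero_symm.mp ?_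
  rcases eq_or_ne j j' with rfl | hj
  · refine inner_gramStep_eq_zero 1 fun i hi => ?_
    rw [inner_pairDet_pairSum_self φ ξ (offPair_of_mem_insert hmj hi).2, one_mul]
  · refine inner_gramStep_eq_zero 0 fun i hi => ?_
    rw [inner_pairDet_pairSum_of_ne φ ξ hj, zero_mul]

theorem pairGram_mem_W_two {j : Fin n} (hj : 2 * s ≤ j.val) (m : Fin s) :
    pairGram h φ ξ j m ∈ W φ s 2 :=
  gramStep_mem fun _ _ => det3_mem_W_two φ (slot_val_lt h _ _) (slot_val_lt h _ _) hj

theorem pairGram_mem_W_three {j : Fin n} (hj : j.val < 2 * s) (m : Fin s) :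
    pairGram h φ ξ j m ∈ W φ s 3 :=
  gramStep_mem fun _ _ => det3_mem_W_three φ (slot_val_lt h _ _) (slot_val_lt h _ _) hj

theorem mem_outer {l : Fin n} : l ∈ outer n s ↔ 2 * s ≤ l.val := by simp [outer]

/-- The second part supplies the earlier pair needed for normalization: index `1` when `k` is the
first pair, index `0` otherwise. -/
theorem mem_J {k m : Fin s} (hm : m ∈ J k) : m ≠ k ∧ ∃ i, i < m ∧ i ≠ k := by
  rw [J] at hm
  split_ifs at hm with hk
  · rw [Finset.mem_filter] at hm
    refine ⟨fun e => by rw [e] at hm; omega, ⟨1, by omega⟩, ?_, ?_⟩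
    · exact Fin.lt_def.mpr (by have := hm.2; simp only; omega)
    · exact fun e => by rw [← e] at hk; simp at hk
  · rw [Finset.mem_filter] at hm
    refine ⟨hm.2.2, ⟨0, by omega⟩, ?_, ?_⟩
    · exact Fin.lt_def.mpr (by have := hm.2; simp only; omega)
    · exact fun e => hk (by rw [← e])

variable (h)

theorem v03_mem_W (x) : v03 (s := s) φ x ∈ W φ s 0 := by
  obtain ⟨⟨a, b, c⟩, hx⟩ := x
  simp only [outer3, Finset.mem_filter, Finset.mem_univ, true_and, Fin.lt_def] at hx
  exact det3_mem_W_zero φ (a := a) (b := b) (c := c) (by omega) (by omega) (by omega)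

theorem v12_mem_W (x) : v12 h φ x ∈ W φ s 1 := by
  obtain ⟨⟨i, b⟩, ⟨j, k⟩, hx⟩ := x
  simp only [outer2, Finset.mem_filter, Finset.mem_univ, true_and, Fin.lt_def] at hx
  exact det3_mem_W_one φ (b := j) (c := k) (slot_val_lt h _ _) (by omega) (by omega)

theorem v21_mem_W (x) : v21 h φ ξ x ∈ W φ s 2 := by
  obtain ⟨⟨⟨⟨i, j⟩, hij⟩, b, b'⟩, ⟨l, hl⟩⟩ | ⟨⟨l, hl⟩, ⟨m, hm⟩⟩ := x
  · exact det3_mem_W_two φ (slot_val_lt h _ _) (slot_val_lt h _ _) (mem_outer.mp hl)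
  · change fOuter h φ ξ l m ∈ _
    rw [fOuter_eq_pairGram h φ ξ (mem_outer.mp hl)]
    exact pairGram_mem_W_two φ ξ (mem_outer.mp hl) m

theorem v30_mem_W (x) : v30 h φ ξ x ∈ W φ s 3 := by
  obtain ⟨⟨⟨i, j, k⟩, hij⟩, b, b', b''⟩ | ⟨k, b, ⟨m, hm⟩⟩ := x
  · exact det3_mem_W_three φ (slot_val_lt h _ _) (slot_val_lt h _ _) (slot_val_lt h _ _)
  · change fInner h φ ξ k b m ∈ _
    rw [fInner_eq_pairGram h φ ξ (mem_J hm).1]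
    exact pairGram_mem_W_three φ ξ (slot_val_lt h _ _) m

/-- A `pairDet` has at least two orbitals below `2 * s`, whereas these determinants have none. -/
theorem v03_pairFree (x) (i : Fin s) (l : Fin n) :
    inner ℂ (pairDet φ h i l) (v03 (s := s) φ x) = 0 := by
  obtain ⟨⟨a, b, c⟩, hx⟩ := x
  simp only [outer3, Finset.mem_filter, Finset.mem_univ, true_and, Fin.lt_def] at hx
  by_contra hne
  have := slot_val_lt h i false
  have := slot_val_lt h i true
  rcases perm_of_inner_det3_ne_zero φ hne with e | e | e | e | e | e <;>
    simp only [Fin.ext_iff] at e <;> omega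

theorem v12_pairFree (x) (i : Fin s) (l : Fin n) :
    inner ℂ (pairDet φ h i l) (v12 h φ x) = 0 := by
  obtain ⟨⟨i', b⟩, ⟨j, k⟩, hx⟩ := x
  simp only [outer2, Finset.mem_filter, Finset.mem_univ, true_and, Fin.lt_def] at hx
  by_contra hne
  have := slot_val_lt h i false
  have := slot_val_lt h i true
  rcases perm_of_inner_det3_ne_zero φ hne with e | e | e | e | e | e <;>
    simp only [Fin.ext_iff] at e <;> omega

/-- The two inner orbitals come from different pairs, so no pair is complete. -/
theorem v21_inl_pairFree (x) (i : Fin s) (l : Fin n) :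
    inner ℂ (pairDet φ h i l) (v21 h φ ξ (Sum.inl x)) = 0 := by
  obtain ⟨⟨⟨⟨i₁, i₂⟩, hi⟩, b₁, b₂⟩, ⟨j, hj⟩⟩ := x
  simp only [pairs2, Finset.mem_filter, Finset.mem_univ, true_and, Fin.lt_def] at hi
  rw [mem_outer] at hj
  by_contra hne
  have := slot_val_lt h i false
  have := slot_val_lt h i true
  have := Bool.toNat_le b₁
  have := Bool.toNat_le b₂
  rcases perm_of_inner_det3_ne_zero φ hne with e | e | e | e | e | e <;>
    simp only [Fin.ext_iff, slot_val, Bool.toNat_true, Bool.toNat_false] at * <;> omega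

theorem v30_inl_pairFree (x) (i : Fin s) (l : Fin n) :
    inner ℂ (pairDet φ h i l) (v30 h φ ξ (Sum.inl x)) = 0 := by
  obtain ⟨⟨⟨i₁, i₂, i₃⟩, hi⟩, b₁, b₂, b₃⟩ := x
  simp only [pairs3, Finset.mem_filter, Finset.mem_univ, true_and, Fin.lt_def] at hi
  by_contra hne
  have := Bool.toNat_le b₁
  have := Bool.toNat_le b₂
  have := Bool.toNat_le b₃
  rcases perm_of_inner_det3_ne_zero φ hne with e | e | e | e | e | e <;>
    simp only [Fin.ext_iff, slot_val, Bool.toNat_true, Bool.toNat_false] at * <;> omega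

theorem v03_orthonormal : Orthonormal ℂ (v03 (s := s) φ) := by
  refine orthonormal_of_inner ?_ ?_
  · rintro ⟨⟨a, b, c⟩, hx⟩
    simp only [outer3, Finset.mem_filter, Finset.mem_univ, true_and] at hx
    exact inner_det3_self φ hx.2.1.ne (hx.2.1.trans hx.2.2).ne hx.2.2.ne
  · rintro ⟨⟨a, b, c⟩, hx⟩ ⟨⟨a', b', c'⟩, hx'⟩ hne
    simp only [Subtype.mk.injEq, Prod.mk.injEq]
    simp only [outer3, Finset.mem_filter, Finset.mem_univ, true_and, Fin.lt_def] at hx hx'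
    rcases perm_of_inner_det3_ne_zero φ hne with e | e | e | e | e | e <;>
      simp only [Fin.ext_iff] at * <;> omega

theorem v12_orthonormal : Orthonormal ℂ (v12 h φ) := by
  refine orthonormal_of_inner ?_ ?_
  · rintro ⟨⟨i, b⟩, ⟨j, k⟩, hx⟩
    simp only [outer2, Finset.mem_filter, Finset.mem_univ, true_and] at hx
    exact inner_det3_self φ (slot_ne h hx.1) (slot_ne h (hx.1.trans hx.2.le)) hx.2.ne
  · rintro ⟨⟨i, b⟩, ⟨j, k⟩, hx⟩ ⟨⟨i', b'⟩, ⟨j', k'⟩, hx'⟩ hne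
    simp only [Subtype.mk.injEq, Prod.mk.injEq, ← slot_inj h]
    simp only [outer2, Finset.mem_filter, Finset.mem_univ, true_and, Fin.lt_def] at hx hx'
    have := slot_val_lt h i b
    have := slot_val_lt h i' b'
    rcases perm_of_inner_det3_ne_zero φ hne with e | e | e | e | e | e <;>
      simp only [Fin.ext_iff] at * <;> omega

theorem v21_orthonormal (hξ : ∀ i, ξ i ≠ 0) : Orthonormal ℂ (v21 h φ ξ) := by
  refine orthonormal_sumElim (orthonormal_of_inner ?_ ?_) (orthonormal_of_inner ?_ ?_) ?_
  · rintro ⟨⟨⟨⟨i₁, i₂⟩, hi⟩, b₁, b₂⟩, ⟨j, hj⟩⟩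
    simp only [pairs2, Finset.mem_filter, Finset.mem_univ, true_and] at hi
    exact inner_det3_self φ (fun e => hi.ne ((slot_inj h).mp e).1) (slot_ne h (mem_outer.mp hj))
      (slot_ne h (mem_outer.mp hj))
  · rintro ⟨⟨⟨⟨i₁, i₂⟩, hi⟩, b₁, b₂⟩, ⟨j, hj⟩⟩ ⟨⟨⟨⟨i₁', i₂'⟩, hi'⟩, b₁', b₂'⟩, ⟨j', hj'⟩⟩ hne
    simp only [pairs2, Finset.mem_filter, Finset.mem_univ, true_and, Fin.lt_def] at hi hi'
    rw [mem_outer] at hj hj'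
    suffices slot h i₁ b₁ = slot h i₁' b₁' ∧ slot h i₂ b₂ = slot h i₂' b₂' ∧ j = j' by
      simp only [slot_inj] at this
      simp [this]
    have := Bool.toNat_le b₁
    have := Bool.toNat_le b₂
    have := Bool.toNat_le b₁'
    have := Bool.toNat_le b₂'
    have := slot_val_lt h i₁ b₁
    have := slot_val_lt h i₂ b₂
    have := slot_val_lt h i₁' b₁'
    have := slot_val_lt h i₂' b₂'
    rcases perm_of_inner_det3_ne_zero φ hne with e | e | e | e | e | e <;>
      simp only [Fin.ext_iff, slot_val] at * <;> omega
  · rintro ⟨⟨l, hl⟩, ⟨m, hm⟩⟩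
    simp only [fromSecond, Finset.mem_filter, Finset.mem_univ, true_and] at hm
    rw [mem_outer] at hl
    simp only [fOuter_eq_pairGram h φ ξ hl]
    exact inner_pairGram_self φ ξ hξ (i := ⟨0, by omega⟩) (offPair_outer h hl)
      (Fin.lt_def.mpr hm) (offPair_outer h hl)
  · rintro ⟨⟨l, hl⟩, ⟨m, hm⟩⟩ ⟨⟨l', hl'⟩, ⟨m', hm'⟩⟩ hne
    simp only [fOuter_eq_pairGram h φ ξ (mem_outer.mp hl),
      fOuter_eq_pairGram h φ ξ (mem_outer.mp hl')] at hne
    obtain ⟨rfl, rfl⟩ := eq_of_inner_pairGram_ne_zero φ ξ (offPair_outer h (mem_outer.mp hl))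
      (offPair_outer h (mem_outer.mp hl')) hne
    rfl
  · rintro x ⟨⟨l, hl⟩, ⟨m, hm⟩⟩
    simp only [fOuter_eq_pairGram h φ ξ (mem_outer.mp hl)]
    exact inner_eq_zero_symm.mp
      (inner_pairGram_of_pairFree h φ ξ (v21_inl_pairFree h φ ξ x) l m)

theorem v30_orthonormal (hξ : ∀ i, ξ i ≠ 0) : Orthonormal ℂ (v30 h φ ξ) := by
  refine orthonormal_sumElim (orthonormal_of_inner ?_ ?_) (orthonormal_of_inner ?_ ?_) ?_
  · rintro ⟨⟨⟨i₁, i₂, i₃⟩, hi⟩, b₁, b₂, b₃⟩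
    simp only [pairs3, Finset.mem_filter, Finset.mem_univ, true_and] at hi
    exact inner_det3_self φ (fun e => hi.1.ne ((slot_inj h).mp e).1)
      (fun e => (hi.1.trans hi.2).ne ((slot_inj h).mp e).1)
      (fun e => hi.2.ne ((slot_inj h).mp e).1)
  · rintro ⟨⟨⟨i₁, i₂, i₃⟩, hi⟩, b₁, b₂, b₃⟩ ⟨⟨⟨i₁', i₂', i₃'⟩, hi'⟩, b₁', b₂', b₃'⟩ hne
    simp only [pairs3, Finset.mem_filter, Finset.mem_univ, true_and, Fin.lt_def] at hi hi'
    suffices slot h i₁ b₁ = slot h i₁' b₁' ∧ slot h i₂ b₂ = slot h i₂' b₂' ∧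
        slot h i₃ b₃ = slot h i₃' b₃' by
      simp only [slot_inj] at this
      simp [this]
    have := Bool.toNat_le b₁
    have := Bool.toNat_le b₂
    have := Bool.toNat_le b₃
    have := Bool.toNat_le b₁'
    have := Bool.toNat_le b₂'
    have := Bool.toNat_le b₃'
    rcases perm_of_inner_det3_ne_zero φ hne with e | e | e | e | e | e <;>
      simp only [Fin.ext_iff, slot_val] at * <;> omega
  · rintro ⟨k, b, ⟨m, hm⟩⟩
    obtain ⟨hmk, i, him, hik⟩ := mem_J hm
    simp only [fInner_eq_pairGram h φ ξ hmk]
    exact inner_pairGram_self φ ξ hξ ((offPair_slot h).mpr hmk) him ((offPair_slot h).mpr hik)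
  · rintro ⟨k, b, ⟨m, hm⟩⟩ ⟨k', b', ⟨m', hm'⟩⟩ hne
    simp only [fInner_eq_pairGram h φ ξ (mem_J hm).1,
      fInner_eq_pairGram h φ ξ (mem_J hm').1] at hne
    obtain ⟨hj, rfl⟩ := eq_of_inner_pairGram_ne_zero φ ξ ((offPair_slot h).mpr (mem_J hm).1)
      ((offPair_slot h).mpr (mem_J hm').1) hne
    obtain ⟨rfl, rfl⟩ := (slot_inj h).mp hj
    rfl
  · rintro x ⟨k, b, ⟨m, hm⟩⟩
    simp only [fInner_eq_pairGram h φ ξ (mem_J hm).1]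
    exact inner_eq_zero_symm.mp
      (inner_pairGram_of_pairFree h φ ξ (v30_inl_pairFree h φ ξ x) _ m)

theorem kerFamily_mem_ker (x) :
    kerFamily h φ ξ x ∈ LinearMap.ker (elemOp (geminal h φ ξ)) := by
  obtain x | x | (x | ⟨⟨l, hl⟩, ⟨m, hm⟩⟩) | (x | ⟨k, b, ⟨m, hm⟩⟩) := x
  · exact mem_ker_of_pairFree h φ ξ (v03_pairFree h φ x)
  · exact mem_ker_of_pairFree h φ ξ (v12_pairFree h φ x)
  · exact mem_ker_of_pairFree h φ ξ (v21_inl_pairFree h φ ξ x)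
  · change fOuter h φ ξ l m ∈ _
    rw [fOuter_eq_pairGram h φ ξ (mem_outer.mp hl)]
    exact pairGram_mem_ker φ ξ (offPair_outer h (mem_outer.mp hl))
  · exact mem_ker_of_pairFree h φ ξ (v30_inl_pairFree h φ ξ x)
  · change fInner h φ ξ k b m ∈ _
    rw [fInner_eq_pairGram h φ ξ (mem_J hm).1]
    exact pairGram_mem_ker φ ξ ((offPair_slot h).mpr (mem_J hm).1)

theorem kerFamily_orthonormal (hξ : ∀ i, ξ i ≠ 0) : Orthonormal ℂ (kerFamily h φ ξ) := by
  have hW : ∀ {a b : Fin 4} {x y : Lambda3 H}, a ≠ b → x ∈ W φ s a → y ∈ W φ s b →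
      inner ℂ x y = 0 := fun hab hx hy =>
    Submodule.isOrtho_iff_inner_eq.mp (W_pairwise_isOrtho φ s hab) _ hx _ hy
  refine orthonormal_sumElim (v03_orthonormal φ) (orthonormal_sumElim (v12_orthonormal h φ)
    (orthonormal_sumElim (v21_orthonormal h φ ξ hξ) (v30_orthonormal h φ ξ hξ) fun x y => ?_)
    fun x y => ?_) fun x y => ?_
  · exact hW (by decide) (v21_mem_W h φ ξ x) (v30_mem_W h φ ξ y)
  · obtain y | y := y
    · exact hW (by decide) (v12_mem_W h φ x) (v21_mem_W h φ ξ y)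
    · exact hW (by decide) (v12_mem_W h φ x) (v30_mem_W h φ ξ y)
  · obtain y | y | y := y
    · exact hW (by decide) (v03_mem_W φ x) (v12_mem_W h φ y)
    · exact hW (by decide) (v03_mem_W φ x) (v21_mem_W h φ ξ y)
    · exact hW (by decide) (v03_mem_W φ x) (v30_mem_W h φ ξ y)

end Families

/-! ### Dimension count, and identification of the four projections -/

section Projections

variable {H : Type*} [NormedAddCommGroup H] [InnerProductSpace ℂ H]
variable {n s : ℕ} (h : 2 * s ≤ n) (φ : OrthonormalBasis (Fin n) ℂ H) (ξ : Fin s → ℂ)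

/-- The spans of the four parts of `kerFamily`. -/
noncomputable def kerPart : Fin 4 → Submodule ℂ (Lambda3 H) :=
  ![Submodule.span ℂ (Set.range (v03 (s := s) φ)), Submodule.span ℂ (Set.range (v12 h φ)),
    Submodule.span ℂ (Set.range (v21 h φ ξ)), Submodule.span ℂ (Set.range (v30 h φ ξ))]

theorem kerPart_le_W (a : Fin 4) : kerPart h φ ξ a ≤ W φ s a := by
  fin_cases a <;> refine Submodule.span_le.mpr ?_ <;> rintro _ ⟨x, rfl⟩
  · exact v03_mem_W φ x
  · exact v12_mem_W h φ x
  · exact v21_mem_W h φ ξ x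
  · exact v30_mem_W h φ ξ x

theorem span_range_kerFamily_eq_iSup :
    Submodule.span ℂ (Set.range (kerFamily h φ ξ)) = ⨆ a, kerPart h φ ξ a := by
  refine le_antisymm (Submodule.span_le.mpr ?_) (iSup_le fun a => ?_)
  · rintro _ ⟨x | x | x | x, rfl⟩
    · exact Submodule.mem_iSup_of_mem 0 (Submodule.subset_span ⟨x, rfl⟩)
    · exact Submodule.mem_iSup_of_mem 1 (Submodule.subset_span ⟨x, rfl⟩)
    · exact Submodule.mem_iSup_of_mem 2 (Submodule.subset_span ⟨x, rfl⟩)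
    · exact Submodule.mem_iSup_of_mem 3 (Submodule.subset_span ⟨x, rfl⟩)
  · fin_cases a <;> refine Submodule.span_mono ?_ <;> rintro _ ⟨x, rfl⟩
    · exact ⟨Sum.inl x, rfl⟩
    · exact ⟨Sum.inr (Sum.inl x), rfl⟩
    · exact ⟨Sum.inr (Sum.inr (Sum.inl x)), rfl⟩
    · exact ⟨Sum.inr (Sum.inr (Sum.inr x)), rfl⟩

variable [FiniteDimensional ℂ H]

/-- Only this inequality is needed: the orthonormal family in the kernel supplies the opposite
bound. -/
theorem finrank_lambda3_le {H : Type*} [NormedAddCommGroup H] [InnerProductSpace ℂ H]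
    [FiniteDimensional ℂ H] {n : ℕ} (φ : OrthonormalBasis (Fin n) ℂ H) :
    Module.finrank ℂ (Lambda3 H) ≤ n.choose 3 := by
  have hle := finrank_range_le_card (R := ℂ) (v03 (s := 0) φ)
  rw [Set.finrank, span_range_v03_zero, finrank_top, Fintype.card_coe, card_outer3] at hle
  simpa using hle

variable {h} in
-- For `j ∈ T` the vectors `pairSum j` are nonzero and pairwise orthogonal, hence independent, and
-- the kernel lies in their orthogonal complement.
theorem finrank_ker_add_card_le (hξ : ∀ i, ξ i ≠ 0) (T : Finset (Fin n))
    (hT : ∀ j ∈ T, ∃ i, OffPair h i j) :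
    Module.finrank ℂ (LinearMap.ker (elemOp (geminal h φ ξ))) + T.card ≤ n.choose 3 := by
  set v : T → Lambda3 H := fun j => pairSum h φ ξ j
  have hv : LinearIndependent ℂ v := by
    refine linearIndependent_of_ne_zero_of_inner_eq_zero (fun j => ?_) fun j j' hj => ?_
    · obtain ⟨i, hi⟩ := hT j j.2
      exact pairSum_ne_zero φ ξ hξ hi
    · exact inner_pairSum_of_ne φ ξ fun e => hj (Subtype.ext e)
  have hker : LinearMap.ker (elemOp (geminal h φ ξ)) ≤ (Submodule.span ℂ (Set.range v))ᗮ := by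
    rw [Submodule.le_orthogonal_iff_le_orthogonal, Submodule.span_le]
    rintro _ ⟨j, rfl⟩ ψ hψ
    exact inner_eq_zero_symm.mp ((mem_ker_elemOp_geminal_iff h φ ξ ψ).mp hψ j)
  have hcard : Module.finrank ℂ (Submodule.span ℂ (Set.range v)) = T.card := by
    rw [finrank_span_eq_card hv, Fintype.card_coe]
  have h1 := Submodule.finrank_mono hker
  have h2 := Submodule.finrank_add_finrank_orthogonal (Submodule.span ℂ (Set.range v))
  have h3 := finrank_lambda3_le φ
  omega

theorem card_v12_index : Fintype.card ((Fin s × Bool) × outer2 n s) =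
    2 * s * (n - 2 * s).choose 2 := by
  rw [Fintype.card_prod, Fintype.card_prod, Fintype.card_fin, Fintype.card_bool, Fintype.card_coe,
    card_outer2, mul_comm s]

theorem card_v21_index :
    Fintype.card (((pairs2 s × Bool × Bool) × outer n s) ⊕ (outer n s × fromSecond s)) =
      4 * (n - 2 * s) * s.choose 2 + (s - 1) * (n - 2 * s) := by
  simp only [Fintype.card_sum, Fintype.card_prod, Fintype.card_bool, Fintype.card_coe, card_pairs2,
    card_outer, card_fromSecond]
  ring

theorem card_v30_index :
    Fintype.card ((pairs3 s × Bool × Bool × Bool) ⊕ ((k : Fin s) × (Bool × J k))) =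
      8 * s.choose 3 + 2 * s * (s - 2) := by
  simp only [Fintype.card_sum, Fintype.card_prod, Fintype.card_bool, Fintype.card_coe, card_pairs3,
    Fintype.card_sigma, card_J, Finset.sum_const, Finset.card_univ, Fintype.card_fin, smul_eq_mul]
  ring

/-- The final `t + 2 * s` counts the vectors `pairSum j`, one per orbital; the other terms count the
kernel family. With `s = k + 2` the truncated subtractions disappear and the claim is a polynomial
identity over `ℚ`. -/
theorem choose_three_decomposition (t : ℕ) {s : ℕ} (hs : 2 ≤ s) :
    (t + 2 * s).choose 3 = t.choose 3 + (2 * s * t.choose 2 +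
      ((4 * t * s.choose 2 + (s - 1) * t) + (8 * s.choose 3 + 2 * s * (s - 2)))) +
        (t + 2 * s) := by
  obtain ⟨k, rfl⟩ := Nat.exists_eq_add_of_le' hs
  rw [Nat.add_sub_cancel, show k + 2 - 1 = k + 1 by omega, ← Nat.cast_inj (R := ℚ)]
  push_cast [cast_choose_three, Nat.cast_choose_two]
  ring

/-- The count for a single pair: its own two orbitals give no nonzero `pairSum`, so only `t` vectors
are excluded. -/
theorem choose_three_add_two (t : ℕ) :
    (t + 2).choose 3 = t.choose 3 + 2 * t.choose 2 + t := by
  rw [← Nat.cast_inj (R := ℚ)]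
  push_cast [cast_choose_three, Nat.cast_choose_two]
  ring

theorem span_range_kerFamily (hs : s ≠ 0) (hξ : ∀ i, ξ i ≠ 0) :
    Submodule.span ℂ (Set.range (kerFamily h φ ξ)) =
      LinearMap.ker (elemOp (geminal h φ ξ)) := by
  have hle : Submodule.span ℂ (Set.range (kerFamily h φ ξ)) ≤
      LinearMap.ker (elemOp (geminal h φ ξ)) := by
    rw [Submodule.span_le]
    rintro _ ⟨x, rfl⟩
    exact kerFamily_mem_ker h φ ξ x
  refine Submodule.eq_of_le_of_finrank_le hle ?_
  rw [finrank_span_eq_card (kerFamily_orthonormal h φ ξ hξ).linearIndependent, Fintype.card_sum,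
    Fintype.card_sum, Fintype.card_sum, Fintype.card_coe, card_outer3, card_v12_index,
    card_v21_index, card_v30_index]
  obtain ⟨t, rfl⟩ := Nat.exists_eq_add_of_le' h
  rw [Nat.add_sub_cancel]
  rcases (by omega : s = 1 ∨ 2 ≤ s) with rfl | hs
  · have := finrank_ker_add_card_le (h := h) φ ξ hξ (outer _ 1) fun j hj =>
      ⟨0, offPair_outer h (mem_outer.mp hj)⟩
    rw [card_outer, choose_three_add_two, Nat.add_sub_cancel] at this
    simp
    omega
  -- With two or more pairs, every orbital is avoided by some pair, so all orbitals may be used.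
  · have := finrank_ker_add_card_le (h := h) φ ξ hξ Finset.univ fun j _ => by
      rcases lt_or_ge j.val (2 * s) with hj | hj
      · obtain ⟨k, b, rfl⟩ := exists_slot_eq h hj
        have : Nontrivial (Fin s) := Fin.nontrivial_iff_two_le.mpr hs
        obtain ⟨i, hi⟩ := exists_ne k
        exact ⟨i, (offPair_slot h).mpr hi⟩
      · exact ⟨⟨0, by omega⟩, offPair_outer h hj⟩
    rw [Finset.card_fin, choose_three_decomposition t hs] at this
    omega

theorem K03_eq : K03 φ s = (Submodule.span ℂ (Set.range (v03 (s := s) φ))).starProjection := by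
  rw [starProjection_span_range (v03_orthonormal φ), K03, ← Finset.sum_coe_sort]
  rfl

theorem K12_eq : K12 h φ = (Submodule.span ℂ (Set.range (v12 h φ))).starProjection := by
  rw [starProjection_span_range (v12_orthonormal h φ), K12, Fintype.sum_prod_type,
    Fintype.sum_prod_type]
  refine Finset.sum_congr rfl fun i _ => ?_
  rw [Fintype.sum_bool, ← Finset.sum_coe_sort, Finset.sum_add_distrib, add_comm]
  rfl

theorem K21_eq (hξ : ∀ i, ξ i ≠ 0) :
    K21 h φ ξ = (Submodule.span ℂ (Set.range (v21 h φ ξ))).starProjection := by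
  rw [starProjection_span_range (v21_orthonormal h φ ξ hξ), K21, Fintype.sum_sum_type]
  congr 1
  · rw [Fintype.sum_prod_type, Fintype.sum_prod_type, ← Finset.sum_coe_sort]
    refine Finset.sum_congr rfl fun i _ => ?_
    simp only [Fintype.sum_prod_type, Fintype.sum_bool, ← Finset.sum_coe_sort (outer n s),
      Finset.sum_add_distrib, v21, Sum.elim_inl, P3, projOnto3, det3]
    abel
  · rw [Fintype.sum_prod_type, ← Finset.sum_coe_sort]
    refine Finset.sum_congr rfl fun i _ => ?_
    rw [← Finset.sum_coe_sort]
    rfl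

theorem K30_eq (hξ : ∀ i, ξ i ≠ 0) :
    K30 h φ ξ = (Submodule.span ℂ (Set.range (v30 h φ ξ))).starProjection := by
  rw [starProjection_span_range (v30_orthonormal h φ ξ hξ), K30, Fintype.sum_sum_type]
  congr 1
  · rw [Fintype.sum_prod_type, ← Finset.sum_coe_sort]
    refine Finset.sum_congr rfl fun i _ => ?_
    simp only [Fintype.sum_prod_type, Fintype.sum_bool, v30, Sum.elim_inl, P3, projOnto3, det3]
    abel
  · rw [Fintype.sum_sigma]
    refine Finset.sum_congr rfl fun k _ => ?_
    rw [Fintype.sum_prod_type, Fintype.sum_bool, ← Finset.sum_coe_sort, Finset.sum_add_distrib,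
      add_comm]
    rfl

/-- Split off `S a`. By the modular law the intersection with `W a` is `S a` joined with the part of
the other summands inside `W a`, and that part vanishes by orthogonality. -/
theorem iSup_inf_eq_of_isOrtho {V ι : Type*} [NormedAddCommGroup V] [InnerProductSpace ℂ V]
    {S W : ι → Submodule ℂ V} (hS : ∀ a, S a ≤ W a) (hW : Pairwise fun a b => W a ⟂ W b) (a : ι) :
    (⨆ b, S b) ⊓ W a = S a := by
  have hort : (⨆ (b) (_ : b ≠ a), S b) ⟂ W a := by
    simp only [Submodule.isOrtho_iSup_left]
    exact fun b hb => (hW hb).mono_left (hS b)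
  rw [iSup_split_single S a, sup_inf_assoc_of_le _ (hS a), hort.disjoint.eq_bot, sup_bot_eq]

theorem K_eq_starProjection (hξ : ∀ i, ξ i ≠ 0) (a : Fin 4) :
    K h φ ξ a = (kerPart h φ ξ a).starProjection := by
  fin_cases a
  · exact K03_eq φ
  · exact K12_eq h φ
  · exact K21_eq h φ ξ hξ
  · exact K30_eq h φ ξ hξ

/-- The two sides carry independent projection instances, which depend on the subspaces; after
substitution they agree by proof irrelevance. -/
theorem starProjection_congr {V : Type*} [NormedAddCommGroup V] [InnerProductSpace ℂ V]
    {A B : Submodule ℂ V} [A.HasOrthogonalProjection] [B.HasOrthogonalProjection] (hAB : A = B) :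
    A.starProjection = B.starProjection := by
  subst hAB
  rfl

theorem finrank_range_starProjection_span {ι V : Type*} [NormedAddCommGroup V]
    [InnerProductSpace ℂ V] [FiniteDimensional ℂ V] [Fintype ι] {v : ι → V}
    (hv : Orthonormal ℂ v) :
    Module.finrank ℂ (Submodule.span ℂ (Set.range v)).starProjection.toLinearMap.range =
      Fintype.card ι := by
  rw [Submodule.range_starProjection, finrank_span_eq_card hv.linearIndependent]

theorem kerFamily_sum_eq (hξ : ∀ i, ξ i ≠ 0) :
    (Submodule.span ℂ (Set.range (kerFamily h φ ξ))).starProjection =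
      K03 φ s + K12 h φ + K21 h φ ξ + K30 h φ ξ := by
  rw [starProjection_span_range (kerFamily_orthonormal h φ ξ hξ), K03_eq, K12_eq, K21_eq h φ ξ hξ,
    K30_eq h φ ξ hξ, starProjection_span_range (v03_orthonormal φ),
    starProjection_span_range (v12_orthonormal h φ),
    starProjection_span_range (v21_orthonormal h φ ξ hξ),
    starProjection_span_range (v30_orthonormal h φ ξ hξ), Fintype.sum_sum_type,
    Fintype.sum_sum_type, Fintype.sum_sum_type, add_assoc, add_assoc]
  rfl

end Projections

end Fermion

/-! ### Assembly of the theorem -/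

theorem theorem2 {H : Type*} [NormedAddCommGroup H] [InnerProductSpace ℂ H]
    [FiniteDimensional ℂ H] {n s : ℕ} (φ : OrthonormalBasis (Fin n) ℂ H)
    (h : 2 * s ≤ n) (ξ : Fin s → ℂ) (hξ : ∀ i, ξ i ≠ 0) (hnorm : ∑ i, ‖ξ i‖ ^ 2 = 1)
    (g : H ⊗[ℂ] H) (hg : g = Fermion.geminal h φ ξ) :
    -- the orthogonal decompositions of the one-particle space and of the antisymmetric space
    (IsCompl (Fermion.R φ s) (Fermion.Rt φ s) ∧ Fermion.R φ s ⟂ Fermion.Rt φ s) ∧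
    (DirectSum.IsInternal (Fermion.W φ s) ∧
      Pairwise fun a b => Fermion.W φ s a ⟂ Fermion.W φ s b) ∧
    -- the projection onto the kernel is the sum of the four pieces
    (LinearMap.ker (Fermion.elemOp g)).starProjection =
      Fermion.K03 φ s + Fermion.K12 h φ + Fermion.K21 h φ ξ + Fermion.K30 h φ ξ ∧
    -- the pieces are mutually orthogonal projections, each onto the part of the kernel
    -- contained in the corresponding summand
    (∀ a, Fermion.K h φ ξ a =
      (LinearMap.ker (Fermion.elemOp g) ⊓ Fermion.W φ s a).starProjection) ∧
    (Pairwise fun a b => Fermion.K h φ ξ a ∘L Fermion.K h φ ξ b = 0) ∧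
    -- the listed functions form an orthonormal basis of the kernel
    (Orthonormal ℂ (Fermion.kerFamily h φ ξ) ∧
      Submodule.span ℂ (Set.range (Fermion.kerFamily h φ ξ)) =
        LinearMap.ker (Fermion.elemOp g)) ∧
    -- the dimension count
    (Module.finrank ℂ (Fermion.K03 φ s).toLinearMap.range = (n - 2 * s).choose 3 ∧
      Module.finrank ℂ (Fermion.K12 h φ).toLinearMap.range = 2 * s * (n - 2 * s).choose 2 ∧
      Module.finrank ℂ (Fermion.K21 h φ ξ).toLinearMap.range =
        4 * (n - 2 * s) * s.choose 2 + (s - 1) * (n - 2 * s) ∧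
      (2 ≤ s → Module.finrank ℂ (Fermion.K30 h φ ξ).toLinearMap.range =
        8 * s.choose 3 + 2 * s * (s - 2)) ∧
      (2 ≤ s → Module.finrank ℂ (LinearMap.ker (Fermion.elemOp g)) + n = n.choose 3) ∧
      (s = 1 → Module.finrank ℂ (Fermion.K30 h φ ξ).toLinearMap.range = 0 ∧
        Module.finrank ℂ (LinearMap.ker (Fermion.elemOp g)) + (n - 2) = n.choose 3)) := by
  subst hg
  -- The normalization of `g` enters only here, to exclude the empty sum.
  have hs : s ≠ 0 := by
    rintro rfl
    simp at hnorm
  have hspan := Fermion.span_range_kerFamily h φ ξ hs hξ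
  have hpart : ∀ a, LinearMap.ker (Fermion.elemOp (Fermion.geminal h φ ξ)) ⊓ Fermion.W φ s a =
      Fermion.kerPart h φ ξ a := fun a => by
    rw [← hspan, Fermion.span_range_kerFamily_eq_iSup]
    exact Fermion.iSup_inf_eq_of_isOrtho (Fermion.kerPart_le_W h φ ξ)
      (Fermion.W_pairwise_isOrtho φ s) a
  have hort := Fermion.kerFamily_orthonormal h φ ξ hξ
  have hdim : Module.finrank ℂ (LinearMap.ker (Fermion.elemOp (Fermion.geminal h φ ξ))) =
      (n - 2 * s).choose 3 + (2 * s * (n - 2 * s).choose 2 +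
        ((4 * (n - 2 * s) * s.choose 2 + (s - 1) * (n - 2 * s)) +
          (8 * s.choose 3 + 2 * s * (s - 2)))) := by
    rw [← hspan, finrank_span_eq_card hort.linearIndependent, Fintype.card_sum, Fintype.card_sum,
      Fintype.card_sum, Fintype.card_coe, Fermion.card_outer3, Fermion.card_v12_index,
      Fermion.card_v21_index, Fermion.card_v30_index]
  have hrank : Module.finrank ℂ (Fermion.K30 h φ ξ).toLinearMap.range =
      8 * s.choose 3 + 2 * s * (s - 2) := by
    rw [Fermion.K30_eq h φ ξ hξ,
      Fermion.finrank_range_starProjection_span (Fermion.v30_orthonormal h φ ξ hξ),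
      Fermion.card_v30_index]
  refine ⟨⟨Fermion.isCompl_R_Rt φ s, Fermion.R_isOrtho_Rt φ s⟩,
    ⟨Fermion.W_isInternal φ s, Fermion.W_pairwise_isOrtho φ s⟩, ?_, fun a => ?_, fun a b hab => ?_,
    ⟨hort, hspan⟩, ?_, ?_, ?_, fun _ => hrank, fun hs2 => ?_, fun hs1 => ⟨?_, ?_⟩⟩
  · rw [← Fermion.kerFamily_sum_eq h φ ξ hξ]
    exact Fermion.starProjection_congr hspan.symm
  · rw [Fermion.K_eq_starProjection h φ ξ hξ]
    exact Fermion.starProjection_congr (hpart a).symm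
  · beta_reduce
    rw [Fermion.K_eq_starProjection h φ ξ hξ, Fermion.K_eq_starProjection h φ ξ hξ]
    exact Submodule.starProjection_comp_starProjection_eq_zero_iff.mpr
      ((Fermion.W_pairwise_isOrtho φ s hab).mono (Fermion.kerPart_le_W h φ ξ a)
        (Fermion.kerPart_le_W h φ ξ b))
  · rw [Fermion.K03_eq, Fermion.finrank_range_starProjection_span (Fermion.v03_orthonormal φ),
      Fintype.card_coe, Fermion.card_outer3]
  · rw [Fermion.K12_eq, Fermion.finrank_range_starProjection_span (Fermion.v12_orthonormal h φ),
      Fermion.card_v12_index]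
  · rw [Fermion.K21_eq h φ ξ hξ,
      Fermion.finrank_range_starProjection_span (Fermion.v21_orthonormal h φ ξ hξ),
      Fermion.card_v21_index]
  · rw [hdim]
    obtain ⟨t, rfl⟩ := Nat.exists_eq_add_of_le' h
    rw [Fermion.choose_three_decomposition t hs2, Nat.add_sub_cancel]
  · subst hs1
    rw [hrank]
    rfl
  · subst hs1
    rw [hdim]
    obtain ⟨t, rfl⟩ := Nat.exists_eq_add_of_le' h
    rw [Fermion.choose_three_add_two]
    simp [Nat.choose_eq_zero_of_lt]
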